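/- Let $\mathbb S^1=\mathbb R/\mathbb Z$ and let $l_1,l_2,l_3\ge 0$ with $l_1+l_2+l_3=1$. Let $F_0:\mathbb S^1\to\mathbb S^1$ be the involution that reverses each of the three open arcs $(0,l_1)$, $(l_1,l_1+l_2)$, $(l_1+l_2,1)$, i.e. $F_0(t)=a+b-t$ for $t$ in the arc $(a,b)$, and fixes their endpoints. For $\tau\in\mathbb S^1$ let $F_\tau^{l_1,l_2,l_3}=R_\tau\circ F_0$, where $R_\tau(p)=p+\tau$; these maps form the family $\mathrm{CET}^3$. Call a map $F:\mathbb S^1\to\mathbb S^1$ minimal if for every $p\in\mathbb S^1$ the orbit $\{F^n(p): n\ge 0\}$ is dense in $\mathbb S^1$. The Rauzy subtractive algorithm acts on triples $(x_1,x_2,x_3)$ with $x_1+x_2+x_3=1$ as follows: if $x_j>\tfrac12$ for some $j$, replace $x_j$ by $2x_j-1$, keep the other two coordinates, and divide the resulting triple by its sum (which equals the old $x_j$); otherwise it cannot be applied. Let $\mathcal R$ be the set of all $(x_1,x_2,x_3)$ with $x_1,x_2,x_3>0$, $x_1+x_2+x_3=1$, to which this algorithm (with the strict inequality $x_j>\tfrac12$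 for some $j$ at each step) can be applied infinitely many times; $\mathcal R$ is the Rauzy gasket (without its boundary). **Theorem.** The map $F_\tau^{l_1,l_2,l_3}$ is minimal if and only if $\tau=\tfrac12$ in $\mathbb R/\mathbb Z$ and $(1-2l_1,\,1-2l_2,\,1-2l_3)\in\mathcal R$. -/

import Mathlib

noncomputable section

open Classical in
/-- The involution of the circle `ℝ/ℤ` that reverses the open arc `(a, b)`, i.e. `t ↦ a + b - t`
there, and is the identity off that arc (used for `0 ≤ a ≤ b ≤ 1`). -/
def arcFlip (a b : ℝ) (p : UnitAddCircle) : UnitAddCircle :=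
  if ∃ t ∈ Set.Ioo a b, (t : UnitAddCircle) = p then ((a + b : ℝ) : UnitAddCircle) - p else p

/-- The global involution `F₀`: the composition of the (commuting) flips of the three arcs
`(0, l₁)`, `(l₁, l₁ + l₂)`, `(l₁ + l₂, l₁ + l₂ + l₃)`. The common endpoints are fixed. -/
def cetInvolution (l : Fin 3 → ℝ) : UnitAddCircle → UnitAddCircle :=
  arcFlip (l 0 + l 1) (l 0 + l 1 + l 2) ∘ arcFlip (l 0) (l 0 + l 1) ∘ arcFlip 0 (l 0)

/-- The map `F_τ^{l₁,l₂,l₃} = R_τ ∘ F₀`, with `R_τ` the rotation by `τ`. -/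
def cetMap (l : Fin 3 → ℝ) (τ : UnitAddCircle) (p : UnitAddCircle) : UnitAddCircle :=
  cetInvolution l p + τ

/-- A (not necessarily continuous) self-map is minimal if the forward orbit of every point is
dense. -/
def IsMinimalMap {X : Type*} [TopologicalSpace X] (F : X → X) : Prop :=
  ∀ p : X, Dense (Set.range fun n : ℕ => F^[n] p)

/-- One step of the Rauzy subtractive algorithm with index `j` in play: `x_j` is replaced by
`2 x_j - 1`, and the triple is divided by its new sum, which is `x_j` when `∑ x_i = 1`. -/
def rauzyStep (j : Fin 3) (x : Fin 3 → ℝ) : Fin 3 → ℝ :=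
  fun i => (if i = j then 2 * x j - 1 else x i) / x j

/-- The Rauzy gasket without its boundary: the triples of the open simplex to which the Rauzy
subtractive algorithm can be applied infinitely often, with some coordinate strictly larger than
`1/2` at each step. -/
def rauzyGasket : Set (Fin 3 → ℝ) :=
  {x | (∀ i, 0 < x i) ∧ ∑ i, x i = 1 ∧
    ∃ y : ℕ → Fin 3 → ℝ, y 0 = x ∧
      ∀ n, ∃ j, 1 / 2 < y n j ∧ y (n + 1) = rauzyStep j (y n)}

end

/-!
A minimal map of the circle has no periodic point. Cutting the circle at an endpoint of the
shortest arc, the first return map to the complement of a suitable interval is again an exchange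
of three flipped arcs followed by the same rotation: its lengths are obtained by subtracting the
shortest arc from the two others. For a map without periodic points this can be repeated forever,
with total length tending to `0`; the difference between the total length and `2 τ` is preserved
throughout, so it vanishes, which is `τ = 1 / 2`. In the coordinates
`1 - 2 l j / (l 0 + l 1 + l 2)` the subtraction is the Rauzy subtractive algorithm.

Conversely, suppose that the subtraction can be repeated forever with `τ` half of the total length.
An orbit segment joining two endpoints would become strictly shorter at each renormalization, and an
interval of points whose orbits avoid the endpoints would survive, with its length, in exchanges of
arbitrarily small total length; so neither exists. As for interval exchanges (Keane), this implies
minimality: a proper closed invariant set would have a gap, and the orbit of that gap would yield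
infinitely many disjoint gaps of the same length.
-/

open Filter Set Topology

section Returns

variable {α β : Type*} {f : α → α} {g : β → β} {ι : β → α} {D : Set β} {A : Set α} {x : β}
  {m n : ℕ}

/-- The `f`-orbit of `ι x` reaches `ι (g x)` at time `n > 0`, and avoids `A` strictly between these
two visits. -/
structure IsReturn (f : α → α) (g : β → β) (ι : β → α) (A : Set α) (x : β) (n : ℕ) : Prop where
  pos : 0 < n
  iterate_eq : f^[n] (ι x) = ι (g x)
  iterate_notMem : ∀ k, 0 < k → k < n → f^[k] (ι x) ∉ A

theorem IsReturn.one (h : f (ι x) = ι (g x)) : IsReturn f g ι A x 1 :=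
  ⟨one_pos, h, fun _ _ _ => by omega⟩

theorem IsReturn.three {y z : α} (hy : f (ι x) = y) (hz : f y = z) (h : f z = ι (g x))
    (hyA : y ∉ A) (hzA : z ∉ A) : IsReturn f g ι A x 3 := by
  subst hy hz
  refine ⟨three_pos, h, fun k hk hk' => ?_⟩
  interval_cases k
  exacts [hyA, hzA]

/-- The map `g` on `D` is induced by `f` through `ι`: it is a power of `f` at each point, with an
exponent that may depend on the point, and the `f`-orbit meets `A` only in `ι '' D`. -/
structure Induces (f : α → α) (g : β → β) (ι : β → α) (D : Set β) (A : Set α) : Prop where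
  mapsTo : MapsTo g D D
  exists_isReturn : ∀ x ∈ D, ∃ n, IsReturn f g ι A x n

theorem Induces.exists_iterate_eq (h : Induces f g ι D A) (hx : x ∈ D) (m : ℕ) :
    ∃ n, m ≤ n ∧ f^[n] (ι x) = ι (g^[m] x) := by
  induction m with
  | zero => exact ⟨0, le_rfl, rfl⟩
  | succ m ih =>
    obtain ⟨n, hmn, hn⟩ := ih
    obtain ⟨k, hk⟩ := h.exists_isReturn _ (h.mapsTo.iterate m hx)
    have := hk.pos
    refine ⟨k + n, by omega, ?_⟩
    rw [Function.iterate_add_apply, hn, hk.iterate_eq, Function.iterate_succ_apply']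

theorem Induces.mem_periodicPts (h : Induces f g ι D A) (hx : x ∈ D)
    (hp : x ∈ Function.periodicPts g) : ι x ∈ Function.periodicPts f := by
  obtain ⟨m, hm, hmx⟩ := hp
  obtain ⟨n, hmn, hn⟩ := h.exists_iterate_eq hx m
  exact ⟨n, hm.trans_le hmn, hn.trans (congrArg ι hmx)⟩

theorem Induces.exists_iterate_mem (h : Induces f g ι D A) (hx : x ∈ D)
    (hm : f^[m] (ι x) ∈ A) : ∃ k ≤ m, ι (g^[k] x) ∈ A := by
  induction m using Nat.strong_induction_on generalizing x with
  | _ m ih =>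
    rcases m.eq_zero_or_pos with rfl | hm₀
    · exact ⟨0, le_rfl, hm⟩
    obtain ⟨n, hn⟩ := h.exists_isReturn x hx
    have hnm : n ≤ m := not_lt.1 fun hlt => hn.iterate_notMem m hm₀ hlt hm
    have hn₀ := hn.pos
    rw [← Nat.sub_add_cancel hnm, Function.iterate_add_apply, hn.iterate_eq] at hm
    obtain ⟨k, hk, hkA⟩ := ih (m - n) (by omega) (h.mapsTo hx) hm
    exact ⟨k + 1, by omega, hkA⟩

theorem Induces.exists_iterate_succ_mem (h : Induces f g ι D A) (hx : x ∈ D)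
    (hn : IsReturn f g ι A x n) (hm₀ : 0 < m) (hm : f^[m] (ι x) ∈ A) :
    ∃ k, k + n ≤ m ∧ ι (g^[k + 1] x) ∈ A := by
  have hnm : n ≤ m := not_lt.1 fun hlt => hn.iterate_notMem m hm₀ hlt hm
  rw [← Nat.sub_add_cancel hnm, Function.iterate_add_apply, hn.iterate_eq] at hm
  obtain ⟨k, hk, hkA⟩ := h.exists_iterate_mem (h.mapsTo hx) hm
  exact ⟨k, by omega, hkA⟩

end Returns

section FlipMap

/-- The exchange of the three flipped arcs `(-a, 0)`, `(0, b)`, `(b, b + c)`, whose endpoints are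
fixed, read on the fundamental domain `[-a, b + c)` of the circle of length `a + b + c`. The origin
is an endpoint of the arc of length `b` because that is the arc subtracted from the two others. -/
noncomputable def flipArcs (a b c x : ℝ) : ℝ :=
  if x = -a ∨ x = 0 ∨ x = b then x
  else if x < 0 then -a - x else if x < b then b - x else 2 * b + c - x

/-- The map `flipArcs` followed by the rotation by `τ ∈ [0, a + b + c]`. -/
noncomputable def flipMap (a b c τ x : ℝ) : ℝ :=
  if flipArcs a b c x + τ < b + c then flipArcs a b c x + τ
  else flipArcs a b c x + τ - (a + b + c)

/-- The endpoints of the three arcs. -/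
def breaks (a b : ℝ) : Set ℝ := {-a, 0, b}

/-- The range of parameters for which `flipMap` preserves its fundamental domain. -/
structure Admissible (a b c τ : ℝ) : Prop where
  left_nonneg : 0 ≤ a
  mid_nonneg : 0 ≤ b
  right_nonneg : 0 ≤ c
  rot_nonneg : 0 ≤ τ
  rot_le : τ ≤ a + b + c

variable {a b c τ x y w : ℝ} {n : ℕ}

theorem mem_breaks : x ∈ breaks a b ↔ x = -a ∨ x = 0 ∨ x = b := Iff.rfl

theorem neg_mem_breaks : -a ∈ breaks a b := Or.inl rfl

theorem zero_mem_breaks : 0 ∈ breaks a b := Or.inr (Or.inl rfl)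

theorem right_mem_breaks : b ∈ breaks a b := Or.inr (Or.inr rfl)

theorem breaks_subset_Ico (h : Admissible a b c τ) (hc : 0 < c) :
    breaks a b ⊆ Ico (-a) (b + c) := by
  obtain ⟨ha, hb, -⟩ := h
  rintro x (rfl | rfl | rfl) <;> constructor <;> linarith

theorem flipArcs_of_mem_breaks (hx : x ∈ breaks a b) : flipArcs a b c x = x := if_pos hx

theorem flipArcs_left (hb : 0 ≤ b) (h₁ : -a < x) (h₂ : x < 0) : flipArcs a b c x = -a - x := by
  have hx : ¬(x = -a ∨ x = 0 ∨ x = b) := by grind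
  rw [flipArcs, if_neg hx, if_pos h₂]

theorem flipArcs_mid (ha : 0 ≤ a) (h₁ : 0 < x) (h₂ : x < b) : flipArcs a b c x = b - x := by
  have hx : ¬(x = -a ∨ x = 0 ∨ x = b) := by grind
  rw [flipArcs, if_neg hx, if_neg h₁.not_gt, if_pos h₂]

theorem flipArcs_right (ha : 0 ≤ a) (hb : 0 ≤ b) (h : b < x) :
    flipArcs a b c x = 2 * b + c - x := by
  have hx : ¬(x = -a ∨ x = 0 ∨ x = b) := by grind
  rw [flipArcs, if_neg hx, if_neg (by linarith), if_neg h.not_gt]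

theorem flipMap_of_lt (h : flipArcs a b c x = y) (hy : y + τ < b + c) :
    flipMap a b c τ x = y + τ := by
  rw [flipMap, h, if_pos hy]

theorem flipMap_of_le (h : flipArcs a b c x = y) (hy : b + c ≤ y + τ) :
    flipMap a b c τ x = y + τ - (a + b + c) := by
  rw [flipMap, h, if_neg hy.not_gt]

theorem Admissible.mapsTo_flipMap (h : Admissible a b c τ) :
    MapsTo (flipMap a b c τ) (Ico (-a) (b + c)) (Ico (-a) (b + c)) := by
  obtain ⟨ha, hb, hc, hτ, hτ'⟩ := h
  rintro x ⟨h₁, h₂⟩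
  simp only [flipMap, flipArcs, mem_Ico]
  split_ifs <;> constructor <;> grind

/-- Some point of the fundamental domain is periodic. -/
def HasPeriodic (a b c τ : ℝ) : Prop :=
  ∃ x ∈ Ico (-a) (b + c), x ∈ Function.periodicPts (flipMap a b c τ)

/-- The forward orbit of some endpoint hits an endpoint at time `n`. -/
def HasConnection (a b c τ : ℝ) (n : ℕ) : Prop :=
  ∃ x ∈ breaks a b, (flipMap a b c τ)^[n] x ∈ breaks a b

/-- The points whose forward orbit, the point itself included, avoids all endpoints. -/
def regularSet (a b c τ : ℝ) : Set ℝ :=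
  {x ∈ Ico (-a) (b + c) | ∀ n, (flipMap a b c τ)^[n] x ∉ breaks a b}

/-- Some open interval of length `w` consists of regular points. -/
def HasRegularInterval (a b c τ w : ℝ) : Prop :=
  ∃ x y, y - x = w ∧ Ioo x y ⊆ regularSet a b c τ

theorem Admissible.mapsTo_regularSet (h : Admissible a b c τ) :
    MapsTo (flipMap a b c τ) (regularSet a b c τ) (regularSet a b c τ) :=
  fun _ hx => ⟨h.mapsTo_flipMap hx.1, fun n => hx.2 (n + 1)⟩

theorem le_or_le_of_Ioo_subset_regularSet {p : ℝ} (hI : Ioo x y ⊆ regularSet a b c τ)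
    (hp : p ∈ breaks a b) : y ≤ p ∨ p ≤ x := by
  by_contra! h
  exact (hI ⟨h.2, h.1⟩).2 0 hp

theorem le_and_le_of_Ioo_subset_regularSet (hI : Ioo x y ⊆ regularSet a b c τ) (hxy : x < y) :
    -a ≤ x ∧ y ≤ b + c := by
  have hcl : closure (Ioo x y) ⊆ Icc (-a) (b + c) :=
    closure_minimal (fun z hz => Ico_subset_Icc_self (hI hz).1) isClosed_Icc
  rwa [closure_Ioo hxy.ne, Icc_subset_Icc_iff hxy.le] at hcl

end FlipMap

section Rotation

variable {a b c τ x w : ℝ} {n : ℕ}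

/-- The coordinate change that moves the origin to the next endpoint, so that the arcs `a, b, c`
are relabelled `b, c, a`. -/
noncomputable def shiftOrigin (a b c x : ℝ) : ℝ := if x < 0 then x + (a + c) else x - b

theorem Admissible.rotate (h : Admissible a b c τ) : Admissible b c a τ :=
  ⟨h.mid_nonneg, h.right_nonneg, h.left_nonneg, h.rot_nonneg, by linarith [h.rot_le]⟩

theorem Admissible.shiftOrigin_mem (h : Admissible a b c τ) (hx : x ∈ Ico (-a) (b + c)) :
    shiftOrigin a b c x ∈ Ico (-b) (c + a) := by
  obtain ⟨ha, hb, hc, -⟩ := h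
  obtain ⟨h₁, h₂⟩ := hx
  unfold shiftOrigin
  split_ifs <;> constructor <;> linarith

theorem Admissible.shiftOrigin_flipMap (h : Admissible a b c τ) (hx : x ∈ Ico (-a) (b + c)) :
    shiftOrigin a b c (flipMap a b c τ x) = flipMap b c a τ (shiftOrigin a b c x) := by
  obtain ⟨ha, hb, hc, hτ, hτ'⟩ := h
  obtain ⟨h₁, h₂⟩ := hx
  simp only [flipMap, flipArcs, shiftOrigin]
  grind

theorem Admissible.shiftOrigin_iterate (h : Admissible a b c τ) (hx : x ∈ Ico (-a) (b + c))
    (n : ℕ) :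
    shiftOrigin a b c ((flipMap a b c τ)^[n] x) = (flipMap b c a τ)^[n] (shiftOrigin a b c x) := by
  induction n with
  | zero => rfl
  | succ n ih =>
    rw [Function.iterate_succ_apply', Function.iterate_succ_apply', ← ih,
      h.shiftOrigin_flipMap (h.mapsTo_flipMap.iterate n hx)]

theorem Admissible.shiftOrigin_mem_breaks_iff (h : Admissible a b c τ) (hc : 0 < c)
    (hx : x ∈ Ico (-a) (b + c)) : shiftOrigin a b c x ∈ breaks b c ↔ x ∈ breaks a b := by
  obtain ⟨ha, hb, -⟩ := h
  obtain ⟨h₁, h₂⟩ := hx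
  simp only [mem_breaks, shiftOrigin]
  grind

theorem Admissible.iterate_shiftOrigin_mem_breaks_iff (h : Admissible a b c τ) (hc : 0 < c)
    (hx : x ∈ Ico (-a) (b + c)) :
    (flipMap b c a τ)^[n] (shiftOrigin a b c x) ∈ breaks b c ↔
      (flipMap a b c τ)^[n] x ∈ breaks a b := by
  rw [← h.shiftOrigin_iterate hx, h.shiftOrigin_mem_breaks_iff hc (h.mapsTo_flipMap.iterate n hx)]

theorem HasPeriodic.rotate (h : Admissible a b c τ) (hp : HasPeriodic a b c τ) :
    HasPeriodic b c a τ := by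
  obtain ⟨x, hx, n, hn, hxn⟩ := hp
  exact ⟨_, h.shiftOrigin_mem hx, n, hn,
    (h.shiftOrigin_iterate hx n).symm.trans (congrArg _ hxn)⟩

theorem HasConnection.rotate (h : Admissible a b c τ) (hc : 0 < c)
    (hn : HasConnection a b c τ n) : HasConnection b c a τ n := by
  obtain ⟨x, hx, hxn⟩ := hn
  have hxD := breaks_subset_Ico h hc hx
  exact ⟨_, (h.shiftOrigin_mem_breaks_iff hc hxD).2 hx,
    (h.iterate_shiftOrigin_mem_breaks_iff hc hxD).2 hxn⟩

theorem Admissible.shiftOrigin_mem_regularSet (h : Admissible a b c τ) (hc : 0 < c)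
    (hx : x ∈ regularSet a b c τ) : shiftOrigin a b c x ∈ regularSet b c a τ :=
  ⟨h.shiftOrigin_mem hx.1,
    fun n hn => hx.2 n ((h.iterate_shiftOrigin_mem_breaks_iff hc hx.1).1 hn)⟩

theorem HasRegularInterval.rotate (h : Admissible a b c τ) (hc : 0 < c)
    (hw : HasRegularInterval a b c τ w) : HasRegularInterval b c a τ w := by
  obtain ⟨x, y, rfl, hI⟩ := hw
  rcases le_or_le_of_Ioo_subset_regularSet hI zero_mem_breaks with hy | hx
  · refine ⟨x + (a + c), y + (a + c), by ring, ?_⟩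
    rw [← image_add_const_Ioo]
    rintro _ ⟨z, hz, rfl⟩
    simpa only [shiftOrigin, if_pos (hz.2.trans_le hy)] using
      h.shiftOrigin_mem_regularSet hc (hI hz)
  · refine ⟨x - b, y - b, by ring, ?_⟩
    rw [← image_sub_const_Ioo]
    rintro _ ⟨z, hz, rfl⟩
    simpa only [shiftOrigin, if_neg (hx.trans hz.1.le).not_gt] using
      h.shiftOrigin_mem_regularSet hc (hI hz)

end Rotation

section Renormalization

/-- The inclusion of the fundamental domain `[b - a, c)` of the renormalized map. On the circle,
whose length has decreased, the point `b - a` is an endpoint, and it stands for the endpoint `-a`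
of the original map. -/
noncomputable def renormIncl (a b x : ℝ) : ℝ := if x = b - a then -a else x

/-- The parameters for which subtracting the middle arc from the two others amounts to inducing. -/
structure Renormalizable (a b c τ : ℝ) : Prop where
  pos : 0 < b
  le_left : b ≤ a
  le_right : b ≤ c
  left_le : a ≤ τ
  right_le : c ≤ τ
  le_left_add : τ ≤ a + b
  le_add_right : τ ≤ b + c
  mid_lt : b < τ
  lt_outer : τ < a + c

/-- A return of `flipMap a b c τ` that realizes `flipMap (a - b) b (c - b) (τ - b)` at `x`. -/
abbrev IsRenormReturn (a b c τ x : ℝ) (n : ℕ) : Prop :=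
  IsReturn (flipMap a b c τ) (flipMap (a - b) b (c - b) (τ - b)) (renormIncl a b) (breaks a b) x n

variable {a b c τ x y w : ℝ} {m n : ℕ}

theorem renormIncl_left : renormIncl a b (b - a) = -a := if_pos rfl

theorem renormIncl_of_ne (h : x ≠ b - a) : renormIncl a b x = x := if_neg h

theorem Renormalizable.admissible (h : Renormalizable a b c τ) : Admissible a b c τ := by
  obtain ⟨hb, hba, hbc, -, -, hτa, -, hbτ, -⟩ := h
  constructor <;> linarith

theorem Renormalizable.admissible_renorm (h : Renormalizable a b c τ) :
    Admissible (a - b) b (c - b) (τ - b) := by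
  obtain ⟨hb, hba, hbc, -, -, hτa, -, hbτ, -⟩ := h
  constructor <;> linarith

theorem Ico_renorm : Ico (-(a - b)) (b + (c - b)) = Ico (b - a) c := by
  rw [neg_sub, add_sub_cancel]

theorem Renormalizable.renormIncl_mem (h : Renormalizable a b c τ) (hx : x ∈ Ico (b - a) c) :
    renormIncl a b x ∈ Ico (-a) (b + c) := by
  obtain ⟨hb, hba, hbc, -⟩ := h
  obtain ⟨h₁, h₂⟩ := hx
  unfold renormIncl
  split_ifs <;> constructor <;> linarith

theorem renormIncl_mem_breaks_iff (hb : 0 < b) (hx : b - a ≤ x) :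
    renormIncl a b x ∈ breaks a b ↔ x ∈ breaks (a - b) b := by
  simp only [mem_breaks, renormIncl]
  grind

theorem Renormalizable.isReturn_endpoint (h : Renormalizable a b c τ) :
    IsRenormReturn a b c τ (b - a) 1 := by
  obtain ⟨hb, -, -, -, -, -, -, hbτ, hτ⟩ := h
  have hbr : b - a ∈ breaks (a - b) b := Or.inl (neg_sub a b).symm
  apply IsReturn.one
  rw [renormIncl_left, flipMap_of_lt (flipArcs_of_mem_breaks neg_mem_breaks) (by linarith),
    flipMap_of_lt (flipArcs_of_mem_breaks hbr) (by linarith),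
    renormIncl_of_ne (ne_of_gt (by linarith))]
  ring

theorem Renormalizable.isReturn_left (h : Renormalizable a b c τ) (h₁ : b - a < x) (h₂ : x < 0) :
    IsRenormReturn a b c τ x 1 := by
  obtain ⟨hb, -, -, haτ, -, -, hτc, -⟩ := h
  apply IsReturn.one
  rw [renormIncl_of_ne h₁.ne',
    flipMap_of_lt (flipArcs_left hb.le (by linarith) h₂) (by linarith),
    flipMap_of_lt (flipArcs_left hb.le (by linarith) h₂) (by linarith),
    renormIncl_of_ne (ne_of_gt (by linarith))]
  ring

theorem Renormalizable.isReturn_right (h : Renormalizable a b c τ) (h₁ : b < x) (h₂ : x < c) :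
    IsRenormReturn a b c τ x 1 := by
  obtain ⟨hb, hba, -, -, hcτ, -⟩ := h
  apply IsReturn.one
  rw [renormIncl_of_ne (ne_of_gt (by linarith)),
    flipMap_of_le (flipArcs_right (by linarith) hb.le h₁) (by linarith),
    flipMap_of_le (flipArcs_right (by linarith) hb.le h₁) (by linarith),
    renormIncl_of_ne (ne_of_gt (by linarith))]
  ring

theorem Renormalizable.isReturn_mid_of_lt (h : Renormalizable a b c τ) (h₁ : 0 < x) (h₂ : x < b)
    (hx : x < τ - c) : IsRenormReturn a b c τ x 3 := by
  obtain ⟨hb, hba, hbc, -, -, -, -, -, hτ⟩ := h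
  have ha : 0 ≤ a := hb.le.trans hba
  have hy : flipMap a b c τ x = τ - x - (a + c) := by
    rw [flipMap_of_le (flipArcs_mid ha h₁ h₂) (by linarith)]; ring
  have hz : flipMap a b c τ (τ - x - (a + c)) = x + c := by
    rw [flipMap_of_lt (flipArcs_left hb.le (by linarith) (by linarith)) (by linarith)]; ring
  refine .three ((congrArg _ (renormIncl_of_ne (ne_of_gt (by linarith)))).trans hy) hz ?_ ?_ ?_
  · rw [flipMap_of_le (flipArcs_right ha hb.le (by linarith)) (by linarith),
      flipMap_of_le (flipArcs_mid (by linarith) h₁ h₂) (by linarith),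
      renormIncl_of_ne (ne_of_gt (by linarith))]
    ring
  · rw [mem_breaks]; rintro (h | h | h) <;> linarith
  · rw [mem_breaks]; rintro (h | h | h) <;> linarith

theorem Renormalizable.isReturn_mid_of_gt (h : Renormalizable a b c τ) (h₁ : 0 < x) (h₂ : x < b)
    (hx : τ - c < x) : IsRenormReturn a b c τ x 3 := by
  obtain ⟨hb, hba, -, -, -, -, -, hbτ, -⟩ := h
  have ha : 0 ≤ a := hb.le.trans hba
  have hy : flipMap a b c τ x = b + τ - x := by
    rw [flipMap_of_lt (flipArcs_mid ha h₁ h₂) (by linarith)]; ring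
  have hz : flipMap a b c τ (b + τ - x) = x - a := by
    rw [flipMap_of_le (flipArcs_right ha hb.le (by linarith)) (by linarith)]; ring
  refine .three ((congrArg _ (renormIncl_of_ne (ne_of_gt (by linarith)))).trans hy) hz ?_ ?_ ?_
  · rw [flipMap_of_lt (flipArcs_left hb.le (by linarith) (by linarith)) (by linarith),
      flipMap_of_lt (flipArcs_mid (by linarith) h₁ h₂) (by linarith),
      renormIncl_of_ne (ne_of_gt (by linarith))]
    ring
  · rw [mem_breaks]; rintro (h | h | h) <;> linarith
  · rw [mem_breaks]; rintro (h | h | h) <;> linarith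

theorem Renormalizable.isReturn_mid_of_eq (h : Renormalizable a b c τ) (h₁ : 0 < x) (h₂ : x < b)
    (hx : x = τ - c) : IsRenormReturn a b c τ x 1 := by
  obtain ⟨-, hba, -⟩ := h
  apply IsReturn.one
  rw [renormIncl_of_ne (ne_of_gt (by linarith)),
    flipMap_of_le (flipArcs_mid (by linarith) h₁ h₂) (by linarith),
    flipMap_of_le (flipArcs_mid (by linarith) h₁ h₂) (by linarith), renormIncl,
    if_pos (by linarith)]
  linarith

theorem Renormalizable.isReturn_zero_of_lt (h : Renormalizable a b c τ) (hba : b < a)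
    (hτc : τ < b + c) : IsRenormReturn a b c τ 0 3 := by
  obtain ⟨hb, -, -, haτ, -, -, -, hbτ, -⟩ := h
  have ha : 0 ≤ a := by linarith
  have hy : flipMap a b c τ 0 = τ := by
    rw [flipMap_of_lt (flipArcs_of_mem_breaks zero_mem_breaks) (by linarith), zero_add]
  have hz : flipMap a b c τ τ = b - a := by
    rw [flipMap_of_le (flipArcs_right ha hb.le hbτ) (by linarith)]; ring
  refine .three ((congrArg _ (renormIncl_of_ne (ne_of_gt (by linarith)))).trans hy) hz ?_ ?_ ?_
  · rw [flipMap_of_lt (flipArcs_left hb.le (by linarith) (by linarith)) (by linarith),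
      flipMap_of_lt (flipArcs_of_mem_breaks zero_mem_breaks) (by linarith),
      renormIncl_of_ne (ne_of_gt (by linarith))]
    ring
  · rw [mem_breaks]; rintro (h | h | h) <;> linarith
  · rw [mem_breaks]; rintro (h | h | h) <;> linarith

theorem isReturn_zero_of_eq (h : 0 ≠ b - a) (hτ : τ = b + c) : IsRenormReturn a b c τ 0 1 := by
  apply IsReturn.one
  rw [renormIncl_of_ne h, flipMap_of_le (flipArcs_of_mem_breaks zero_mem_breaks) (by linarith),
    flipMap_of_le (flipArcs_of_mem_breaks zero_mem_breaks) (by linarith), renormIncl,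
    if_pos (by linarith)]
  linarith

theorem Renormalizable.isReturn_self_of_lt (h : Renormalizable a b c τ) (hbc : b < c)
    (hcτ : c < τ) : IsRenormReturn a b c τ b 3 := by
  obtain ⟨hb, hba, -, -, -, hτa, -⟩ := h
  have ha : 0 ≤ a := hb.le.trans hba
  have hy : flipMap a b c τ b = τ - (a + c) := by
    rw [flipMap_of_le (flipArcs_of_mem_breaks right_mem_breaks) (by linarith)]; ring
  have hz : flipMap a b c τ (τ - (a + c)) = c := by
    rw [flipMap_of_lt (flipArcs_left hb.le (by linarith) (by linarith)) (by linarith)]; ring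
  refine .three ((congrArg _ (renormIncl_of_ne (ne_of_gt (by linarith)))).trans hy) hz ?_ ?_ ?_
  · rw [flipMap_of_le (flipArcs_right ha hb.le hbc) (by linarith),
      flipMap_of_le (flipArcs_of_mem_breaks right_mem_breaks) (by linarith),
      renormIncl_of_ne (ne_of_gt (by linarith))]
    ring
  · rw [mem_breaks]; rintro (h | h | h) <;> linarith
  · rw [mem_breaks]; rintro (h | h | h) <;> linarith

theorem Renormalizable.isReturn_self_of_eq (h : Renormalizable a b c τ) (hcτ : c = τ) :
    IsRenormReturn a b c τ b 1 := by
  obtain ⟨hb, hba, -⟩ := h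
  apply IsReturn.one
  rw [renormIncl_of_ne (ne_of_gt (by linarith)),
    flipMap_of_le (flipArcs_of_mem_breaks right_mem_breaks) (by linarith),
    flipMap_of_le (flipArcs_of_mem_breaks right_mem_breaks) (by linarith), renormIncl,
    if_pos (by linarith)]
  linarith

theorem Renormalizable.exists_isReturn (h : Renormalizable a b c τ) (hx : x ∈ Ico (b - a) c) :
    ∃ n, IsRenormReturn a b c τ x n := by
  rcases hx.1.eq_or_lt with rfl | hx₁
  · exact ⟨1, h.isReturn_endpoint⟩
  rcases lt_trichotomy x 0 with hx₀ | rfl | hx₀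
  · exact ⟨1, h.isReturn_left hx₁ hx₀⟩
  · rcases h.le_add_right.lt_or_eq with hτ | hτ
    exacts [⟨3, h.isReturn_zero_of_lt (sub_neg.1 hx₁) hτ⟩, ⟨1, isReturn_zero_of_eq hx₁.ne' hτ⟩]
  rcases lt_trichotomy x b with hxb | rfl | hxb
  · rcases lt_trichotomy x (τ - c) with hxτ | hxτ | hxτ
    exacts [⟨3, h.isReturn_mid_of_lt hx₀ hxb hxτ⟩, ⟨1, h.isReturn_mid_of_eq hx₀ hxb hxτ⟩,
      ⟨3, h.isReturn_mid_of_gt hx₀ hxb hxτ⟩]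
  · rcases h.right_le.lt_or_eq with hτ | hτ
    exacts [⟨3, h.isReturn_self_of_lt hx.2 hτ⟩, ⟨1, h.isReturn_self_of_eq hτ⟩]
  · exact ⟨1, h.isReturn_right hxb hx.2⟩

theorem Renormalizable.induces (h : Renormalizable a b c τ) :
    Induces (flipMap a b c τ) (flipMap (a - b) b (c - b) (τ - b)) (renormIncl a b) (Ico (b - a) c)
      (breaks a b) where
  mapsTo := by simpa only [Ico_renorm] using h.admissible_renorm.mapsTo_flipMap
  exists_isReturn _ hx := h.exists_isReturn hx

theorem HasPeriodic.of_renorm (h : Renormalizable a b c τ)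
    (hp : HasPeriodic (a - b) b (c - b) (τ - b)) : HasPeriodic a b c τ := by
  obtain ⟨x, hx, hper⟩ := hp
  rw [Ico_renorm] at hx
  exact ⟨_, h.renormIncl_mem hx, h.induces.mem_periodicPts hx hper⟩

theorem Renormalizable.mem_breaks_of_renormIncl_iterate_mem (h : Renormalizable a b c τ)
    (hx : x ∈ Ico (b - a) c)
    (hm : renormIncl a b ((flipMap (a - b) b (c - b) (τ - b))^[m] x) ∈ breaks a b) :
    (flipMap (a - b) b (c - b) (τ - b))^[m] x ∈ breaks (a - b) b :=
  (renormIncl_mem_breaks_iff h.pos (h.induces.mapsTo.iterate m hx).1).1 hm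

/-- The parameters for which the arcs subtracted from do not vanish and, moreover, no endpoint is
sent to another one within one step of the renormalization. -/
structure StrictlyRenormalizable (a b c τ : ℝ) : Prop where
  pos : 0 < b
  lt_left : b < a
  lt_right : b < c
  left_lt : a < τ
  right_lt : c < τ
  lt_left_add : τ < a + b
  lt_add_right : τ < b + c
  lt_outer : τ < a + c

theorem StrictlyRenormalizable.renormalizable (h : StrictlyRenormalizable a b c τ) :
    Renormalizable a b c τ :=
  ⟨h.pos, h.lt_left.le, h.lt_right.le, h.left_lt.le, h.right_lt.le, h.lt_left_add.le,
    h.lt_add_right.le, h.lt_left.trans h.left_lt, h.lt_outer⟩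

theorem StrictlyRenormalizable.isReturn_sub_left (h : StrictlyRenormalizable a b c τ)
    (hac : a ≠ c) : IsRenormReturn a b c τ (τ - a) 3 := by
  have h₁ : 0 < τ - a := sub_pos.2 h.left_lt
  have h₂ : τ - a < b := by linarith [h.lt_left_add]
  rcases hac.lt_or_gt with hac | hac
  exacts [h.renormalizable.isReturn_mid_of_gt h₁ h₂ (by linarith),
    h.renormalizable.isReturn_mid_of_lt h₁ h₂ (by linarith)]

theorem Renormalizable.exists_iterate_succ_mem_breaks (h : Renormalizable a b c τ)
    (h₁ : b - a < x) (h₂ : x < c) (hn : IsRenormReturn a b c τ x n) (hm₀ : 0 < m)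
    (hm : (flipMap a b c τ)^[m] x ∈ breaks a b) :
    ∃ k, k + n ≤ m ∧ (flipMap (a - b) b (c - b) (τ - b))^[k + 1] x ∈ breaks (a - b) b := by
  rw [← renormIncl_of_ne h₁.ne'] at hm
  obtain ⟨k, hk, hkA⟩ := h.induces.exists_iterate_succ_mem ⟨h₁.le, h₂⟩ hn hm₀ hm
  exact ⟨k, hk, h.mem_breaks_of_renormIncl_iterate_mem ⟨h₁.le, h₂⟩ hkA⟩

/-- Endpoints return after three steps, so passing to the induced map shortens a connection. -/
theorem HasConnection.renorm (h : StrictlyRenormalizable a b c τ) (hac : a ≠ c) (hm₀ : 0 < m)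
    (hm : HasConnection a b c τ m) :
    ∃ k < m, 0 < k ∧ HasConnection (a - b) b (c - b) (τ - b) k := by
  have hr := h.renormalizable
  have ⟨hb, hba, hbc, haτ, hcτ, hτa, hτc, _⟩ := h
  obtain ⟨x, rfl | rfl | rfl, hxm⟩ := hm
  · have hneg : flipMap a b c τ (-a) = τ - a := by
      rw [flipMap_of_lt (flipArcs_of_mem_breaks neg_mem_breaks) (by linarith)]
      ring
    have hleft : flipMap (a - b) b (c - b) (τ - b) (b - a) = τ - a := by
      rw [flipMap_of_lt (flipArcs_of_mem_breaks (Or.inl (neg_sub a b).symm)) (by linarith)]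
      ring
    obtain ⟨m, rfl⟩ := Nat.exists_eq_add_one.2 hm₀
    rw [Function.iterate_succ_apply, hneg] at hxm
    have hm₁ : 0 < m := by
      refine Nat.pos_of_ne_zero ?_
      rintro rfl
      rcases mem_breaks.1 hxm with h | h | h <;> simp only [Function.iterate_zero, id] at h <;>
        linarith
    obtain ⟨k, hk, hkA⟩ := hr.exists_iterate_succ_mem_breaks (by linarith) (by linarith)
      (h.isReturn_sub_left hac) hm₁ hxm
    refine ⟨k + 2, by omega, by omega, b - a, Or.inl (neg_sub a b).symm, ?_⟩
    rwa [Function.iterate_succ_apply, hleft]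
  · obtain ⟨k, hk, hkA⟩ := hr.exists_iterate_succ_mem_breaks (by linarith) (by linarith)
      (hr.isReturn_zero_of_lt hba hτc) hm₀ hxm
    exact ⟨k + 1, by omega, by omega, 0, zero_mem_breaks, hkA⟩
  · obtain ⟨k, hk, hkA⟩ := hr.exists_iterate_succ_mem_breaks (by linarith) (by linarith)
      (hr.isReturn_self_of_lt hbc hcτ) hm₀ hxm
    exact ⟨k + 1, by omega, by omega, x, right_mem_breaks, hkA⟩

theorem Renormalizable.mem_regularSet (h : Renormalizable a b c τ) (hx : x ∈ regularSet a b c τ)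
    (h₁ : b - a < x) (h₂ : x < c) : x ∈ regularSet (a - b) b (c - b) (τ - b) := by
  have hxD : x ∈ Ico (b - a) c := ⟨h₁.le, h₂⟩
  refine ⟨by rwa [Ico_renorm], fun m hm => ?_⟩
  obtain ⟨n, -, hn⟩ := h.induces.exists_iterate_eq hxD m
  rw [renormIncl_of_ne h₁.ne'] at hn
  refine hx.2 n (hn ▸ (renormIncl_mem_breaks_iff h.pos (h.induces.mapsTo.iterate m hxD).1).2 hm)

theorem HasRegularInterval.of_Ioo_subset (h : Renormalizable a b c τ)
    (hI : Ioo x y ⊆ regularSet a b c τ) (h₁ : b - a ≤ x) (h₂ : y ≤ c) :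
    HasRegularInterval (a - b) b (c - b) (τ - b) (y - x) :=
  ⟨x, y, rfl, fun _ hz => h.mem_regularSet (hI hz) (h₁.trans_lt hz.1) (hz.2.trans_le h₂)⟩

theorem Renormalizable.Ioo_left_subset_regularSet (h : Renormalizable a b c τ)
    (hI : Ioo x y ⊆ regularSet a b c τ) (hx : -a ≤ x) (hy : y ≤ 0) :
    Ioo (τ - a - y) (τ - a - x) ⊆ regularSet a b c τ := by
  have hmaps := h.admissible.mapsTo_regularSet
  obtain ⟨hb, -, -, -, -, -, hτc, -⟩ := h
  rw [← image_const_sub_Ioo]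
  rintro _ ⟨z, hz, rfl⟩
  convert hmaps (hI hz) using 1
  obtain ⟨hxz, hzy⟩ := hz
  rw [flipMap_of_lt (flipArcs_left hb.le (by linarith) (by linarith)) (by linarith)]
  ring

theorem Renormalizable.Ioo_right_subset_regularSet (h : Renormalizable a b c τ)
    (hI : Ioo x y ⊆ regularSet a b c τ) (hx : b ≤ x) (hy : y ≤ b + c) :
    Ioo (b + τ - a - y) (b + τ - a - x) ⊆ regularSet a b c τ := by
  have hmaps := h.admissible.mapsTo_regularSet
  obtain ⟨hb, hba, -, -, hcτ, -⟩ := h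
  rw [← image_const_sub_Ioo]
  rintro _ ⟨z, hz, rfl⟩
  convert hmaps (hI hz) using 1
  obtain ⟨hxz, hzy⟩ := hz
  rw [flipMap_of_le (flipArcs_right (by linarith) hb.le (by linarith)) (by linarith)]
  ring

theorem HasRegularInterval.of_left (h : Renormalizable a b c τ)
    (hI : Ioo x y ⊆ regularSet a b c τ) (hx : -a ≤ x) (hy : y ≤ 0) :
    HasRegularInterval (a - b) b (c - b) (τ - b) (y - x) := by
  have hI₁ := h.Ioo_left_subset_regularSet hI hx hy
  have ⟨_, _, hbc, _, _, _, hτc, _, _⟩ := h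
  rcases le_or_le_of_Ioo_subset_regularSet hI₁ right_mem_breaks with hright | hleft
  · convert of_Ioo_subset h hI₁ (by linarith) (by linarith) using 1
    ring
  · have hI₂ := h.Ioo_right_subset_regularSet hI₁ hleft (by linarith)
    convert of_Ioo_subset h hI₂ (by linarith) (by linarith) using 1
    ring

theorem HasRegularInterval.of_right (h : Renormalizable a b c τ)
    (hI : Ioo x y ⊆ regularSet a b c τ) (hx : b ≤ x) (hy : y ≤ b + c) :
    HasRegularInterval (a - b) b (c - b) (τ - b) (y - x) := by
  have hI₁ := h.Ioo_right_subset_regularSet hI hx hy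
  have ⟨_, hba, hbc, _, hcτ, hτa, _, _, _⟩ := h
  rcases le_or_le_of_Ioo_subset_regularSet hI₁ zero_mem_breaks with hright | hleft
  · have hI₂ := h.Ioo_left_subset_regularSet hI₁ (by linarith) hright
    convert of_Ioo_subset h hI₂ (by linarith) (by linarith) using 1
    ring
  · convert of_Ioo_subset h hI₁ (by linarith) (by linarith) using 1
    ring

theorem HasRegularInterval.renorm (h : Renormalizable a b c τ) (hw : 0 < w)
    (hI : HasRegularInterval a b c τ w) : HasRegularInterval (a - b) b (c - b) (τ - b) w := by
  obtain ⟨x, y, rfl, hI⟩ := hI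
  have hxy : x < y := sub_pos.1 hw
  obtain ⟨hx, hy⟩ := le_and_le_of_Ioo_subset_regularSet hI hxy
  rcases le_or_le_of_Ioo_subset_regularSet hI zero_mem_breaks with hy₀ | hx₀
  · exact of_left h hI hx hy₀
  rcases le_or_le_of_Ioo_subset_regularSet hI right_mem_breaks with hyb | hxb
  · exact of_Ioo_subset h hI ((sub_nonpos.2 h.le_left).trans hx₀) (hyb.trans h.le_right)
  · exact of_right h hI hxb hy

end Renormalization

section CyclicOrder

variable {l : Fin 3 → ℝ} {τ w : ℝ} {n : ℕ} {i : Fin 3}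

theorem forall_of_rotate {P : ℝ → ℝ → ℝ → Prop}
    (hP : ∀ j, P (l (j + 2)) (l j) (l (j + 1)) → P (l j) (l (j + 1)) (l (j + 2)))
    (h : P (l (i + 2)) (l i) (l (i + 1))) (j : Fin 3) : P (l (j + 2)) (l j) (l (j + 1)) := by
  have h₀ := hP 0
  have h₁ := hP 1
  have h₂ := hP 2
  fin_cases i <;> fin_cases j <;> simp_all

theorem sum_eq_add_add (l : Fin 3 → ℝ) (j : Fin 3) : ∑ i, l i = l (j + 2) + l j + l (j + 1) := by
  rw [Fin.sum_univ_three]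
  fin_cases j <;> simp <;> ring

theorem Admissible.rotate_all (h : Admissible (l (i + 2)) (l i) (l (i + 1)) τ) (j : Fin 3) :
    Admissible (l (j + 2)) (l j) (l (j + 1)) τ :=
  forall_of_rotate (P := (Admissible · · · τ)) (fun _ h => h.rotate) h j

theorem HasPeriodic.rotate_all (h : Admissible (l (i + 2)) (l i) (l (i + 1)) τ)
    (hp : HasPeriodic (l (i + 2)) (l i) (l (i + 1)) τ) (j : Fin 3) :
    HasPeriodic (l (j + 2)) (l j) (l (j + 1)) τ :=
  forall_of_rotate (P := (HasPeriodic · · · τ)) (fun k hk => hk.rotate (h.rotate_all k)) hp j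

theorem HasConnection.rotate_all (h : Admissible (l (i + 2)) (l i) (l (i + 1)) τ)
    (hl : ∀ k, 0 < l k) (hn : HasConnection (l (i + 2)) (l i) (l (i + 1)) τ n) (j : Fin 3) :
    HasConnection (l (j + 2)) (l j) (l (j + 1)) τ n :=
  forall_of_rotate (P := (HasConnection · · · τ n))
    (fun k hk => hk.rotate (h.rotate_all k) (hl _)) hn j

theorem HasRegularInterval.rotate_all (h : Admissible (l (i + 2)) (l i) (l (i + 1)) τ)
    (hl : ∀ k, 0 < l k) (hw : HasRegularInterval (l (i + 2)) (l i) (l (i + 1)) τ w) (j : Fin 3) :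
    HasRegularInterval (l (j + 2)) (l j) (l (j + 1)) τ w :=
  forall_of_rotate (P := (HasRegularInterval · · · τ w))
    (fun k hk => hk.rotate (h.rotate_all k) (hl _)) hw j

end CyclicOrder

section Subtraction

/-- Subtract the arc `j` from the two others. -/
def subtractArc (j : Fin 3) (l : Fin 3 → ℝ) : Fin 3 → ℝ :=
  fun i => if i = j then l j else l i - l j

/-- The strict triangle inequalities: each arc is shorter than half of the total length. -/
def IsTriangular (l : Fin 3 → ℝ) : Prop :=
  ∀ i, 2 * l i < ∑ k, l k

/-- An infinite process that subtracts the arc `j n` at time `n` and never violates the triangle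
inequalities. -/
structure IsSubtraction (L : ℕ → Fin 3 → ℝ) (j : ℕ → Fin 3) : Prop where
  succ : ∀ n, L (n + 1) = subtractArc (j n) (L n)
  isTriangular : ∀ n, IsTriangular (L n)

/-- Arcs can be subtracted forever from `l` without violating the triangle inequalities. -/
def Inexhaustible (l : Fin 3 → ℝ) : Prop :=
  ∃ L j, L 0 = l ∧ IsSubtraction L j

variable {l : Fin 3 → ℝ} {L : ℕ → Fin 3 → ℝ} {j : ℕ → Fin 3} {p q : Fin 3}

theorem subtractArc_self (i : Fin 3) (l : Fin 3 → ℝ) : subtractArc i l i = l i := if_pos rfl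

theorem subtractArc_of_ne (h : p ≠ q) (l : Fin 3 → ℝ) : subtractArc q l p = l p - l q := if_neg h

theorem subtractArc_add_one (i : Fin 3) (l : Fin 3 → ℝ) :
    subtractArc i l (i + 1) = l (i + 1) - l i :=
  subtractArc_of_ne (by fin_cases i <;> decide) l

theorem subtractArc_add_two (i : Fin 3) (l : Fin 3 → ℝ) :
    subtractArc i l (i + 2) = l (i + 2) - l i :=
  subtractArc_of_ne (by fin_cases i <;> decide) l

theorem sum_subtractArc (i : Fin 3) (l : Fin 3 → ℝ) :
    ∑ k, subtractArc i l k = ∑ k, l k - 2 * l i := by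
  rw [sum_eq_add_add _ i, sum_eq_add_add l i, subtractArc_self, subtractArc_add_one,
    subtractArc_add_two]
  ring

theorem IsTriangular.pos (h : IsTriangular l) (i : Fin 3) : 0 < l i := by
  have h₁ := h (i + 1)
  have h₂ := h (i + 2)
  rw [sum_eq_add_add l i] at h₁ h₂
  linarith

theorem IsTriangular.sum_pos (h : IsTriangular l) : 0 < ∑ k, l k := by
  linarith [h 0, h.pos 0]

theorem IsTriangular.sum_lt (h : IsTriangular l) (hpq : p ≠ q) :
    ∑ k, l k < 2 * (l p + l q) := by
  have h₀ := h 0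
  have h₁ := h 1
  have h₂ := h 2
  rw [Fin.sum_univ_three] at *
  fin_cases p <;> fin_cases q <;>
    first | exact absurd rfl hpq | (simp only [Fin.reduceFinMk]; linarith)

theorem IsSubtraction.tail (h : IsSubtraction L j) :
    IsSubtraction (fun n => L (n + 1)) fun n => j (n + 1) :=
  ⟨fun n => h.succ (n + 1), fun n => h.isTriangular (n + 1)⟩

theorem IsSubtraction.sum_succ (h : IsSubtraction L j) (n : ℕ) :
    ∑ k, L (n + 1) k = ∑ k, L n k - 2 * L n (j n) := by
  rw [h.succ, sum_subtractArc]

theorem IsSubtraction.exists_tendsto_sum (h : IsSubtraction L j) :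
    ∃ s, (∀ n, s ≤ ∑ k, L n k) ∧ Tendsto (fun n => ∑ k, L n k) atTop (𝓝 s) := by
  have hanti : Antitone fun n => ∑ k, L n k :=
    antitone_nat_of_succ_le fun n => by linarith [h.sum_succ n, (h.isTriangular n).pos (j n)]
  have hbdd : BddBelow (range fun n => ∑ k, L n k) :=
    ⟨0, forall_mem_range.2 fun n => (h.isTriangular n).sum_pos.le⟩
  exact ⟨_, fun n => ciInf_le hbdd n, tendsto_atTop_ciInf hanti hbdd⟩

theorem IsSubtraction.tendsto_apply_index (h : IsSubtraction L j) :
    Tendsto (fun n => L n (j n)) atTop (𝓝 0) := by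
  obtain ⟨s, -, hs⟩ := h.exists_tendsto_sum
  have hdiff := (hs.sub (hs.comp (tendsto_add_atTop_nat 1))).div_const 2
  rw [sub_self, zero_div] at hdiff
  refine hdiff.congr fun n => ?_
  rw [Function.comp_apply, h.sum_succ]
  ring

theorem IsSubtraction.exists_index_ne (h : IsSubtraction L j) (N : ℕ) (i : Fin 3) :
    ∃ n ≥ N, j n ≠ i := by
  by_contra! hj
  have hconst (n : ℕ) (hn : N ≤ n) : L n i = L N i := by
    induction n, hn using Nat.le_induction with
    | base => rfl
    | succ n hn ih => rw [h.succ, hj n hn, subtractArc_self, ih]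
  have hlim : Tendsto (fun _ : ℕ => L N i) atTop (𝓝 0) := h.tendsto_apply_index.congr' <| by
    filter_upwards [eventually_ge_atTop N] with n hn
    rw [hj n hn, hconst n hn]
  exact ((h.isTriangular N).pos i).ne' (tendsto_const_nhds_iff.1 hlim)

/-- If the total length stayed above `s > 0`, then, the subtracted arcs becoming short, the same arc
would eventually be subtracted forever: two different short arcs would violate the triangle
inequality for the third. -/
theorem IsSubtraction.tendsto_sum (h : IsSubtraction L j) :
    Tendsto (fun n => ∑ k, L n k) atTop (𝓝 0) := by
  obtain ⟨s, hs, hlim⟩ := h.exists_tendsto_sum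
  have hs₀ : 0 ≤ s := ge_of_tendsto' hlim fun n => (h.isTriangular n).sum_pos.le
  suffices s = 0 by rwa [this] at hlim
  by_contra hne
  have hquarter : 0 < s / 4 := div_pos (hs₀.lt_of_ne' hne) four_pos
  obtain ⟨N, hN⟩ := eventually_atTop.1 (h.tendsto_apply_index.eventually_lt_const hquarter)
  have hsame (n : ℕ) (hn : N ≤ n) : j (n + 1) = j n := by
    by_contra hj
    have hsum := (h.isTriangular (n + 1)).sum_lt hj
    have hprev : L (n + 1) (j n) = L n (j n) := by rw [h.succ, subtractArc_self]
    linarith [hs (n + 1), hN n hn, hN (n + 1) (by omega)]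
  have hconst (n : ℕ) (hn : N ≤ n) : j n = j N := by
    induction n, hn using Nat.le_induction with
    | base => rfl
    | succ n hn ih => rw [hsame n hn, ih]
  obtain ⟨n, hn, hjn⟩ := h.exists_index_ne N (j N)
  exact hjn (hconst n hn)

/-- Equal arcs stay equal, since subtracting one of them would annihilate the other; hence only the
third arc could ever be subtracted. -/
theorem IsSubtraction.injective_zero (h : IsSubtraction L j) : Function.Injective (L 0) := by
  intro p q hpq
  by_contra hne
  have hj (n : ℕ) (hn : L n p = L n q) : j n ≠ p ∧ j n ≠ q := by
    constructor
    · rintro rfl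
      have hpos := (h.isTriangular (n + 1)).pos q
      rw [h.succ, subtractArc_of_ne (Ne.symm hne), hn, sub_self] at hpos
      exact hpos.false
    · rintro rfl
      have hpos := (h.isTriangular (n + 1)).pos p
      rw [h.succ, subtractArc_of_ne hne, hn, sub_self] at hpos
      exact hpos.false
  have heq (n : ℕ) : L n p = L n q := by
    induction n with
    | zero => exact hpq
    | succ n ih =>
      rw [h.succ, subtractArc_of_ne (hj n ih).1.symm, subtractArc_of_ne (hj n ih).2.symm, ih]
  obtain ⟨n, -, hn⟩ := h.exists_index_ne 0 (j 0)
  have h₀ := hj 0 (heq 0)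
  have hn' := hj n (heq n)
  omega

theorem Inexhaustible.isTriangular (h : Inexhaustible l) : IsTriangular l := by
  obtain ⟨L, j, rfl, h⟩ := h
  exact h.isTriangular 0

theorem Inexhaustible.exists_subtractArc (h : Inexhaustible l) :
    ∃ i, Inexhaustible (subtractArc i l) := by
  obtain ⟨L, j, rfl, h⟩ := h
  exact ⟨j 0, _, _, h.succ 0, h.tail⟩

theorem Inexhaustible.injective (h : Inexhaustible l) : Function.Injective l := by
  obtain ⟨L, j, rfl, h⟩ := h
  exact h.injective_zero

theorem exists_isSubtraction_of_forall_exists {P : (Fin 3 → ℝ) → Prop}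
    (hP : ∀ m, P m → IsTriangular m ∧ ∃ i, P (subtractArc i m)) (hl : P l) :
    ∃ L j, L 0 = l ∧ IsSubtraction L j ∧ ∀ n, P (L n) := by
  choose! i hi using fun m hm => (hP m hm).2
  let L (n : ℕ) : Fin 3 → ℝ := (fun m => subtractArc (i m) m)^[n] l
  have hsucc (n : ℕ) : L (n + 1) = subtractArc (i (L n)) (L n) := Function.iterate_succ_apply' _ n l
  have hL (n : ℕ) : P (L n) := by
    induction n with
    | zero => exact hl
    | succ n ih => exact hsucc n ▸ hi _ ih
  exact ⟨L, fun n => i (L n), rfl, ⟨hsucc, fun n => (hP _ (hL n)).1⟩, hL⟩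

end Subtraction

section Transfer

variable {l : Fin 3 → ℝ} {i : Fin 3} {τ w : ℝ} {n : ℕ}

theorem Renormalizable.admissible_subtractArc
    (h : Renormalizable (l (i + 2)) (l i) (l (i + 1)) τ) :
    Admissible (subtractArc i l (i + 2)) (subtractArc i l i) (subtractArc i l (i + 1))
      (τ - l i) := by
  rw [subtractArc_add_two, subtractArc_self, subtractArc_add_one]
  exact h.admissible_renorm

theorem HasPeriodic.of_subtractArc (h : Renormalizable (l (i + 2)) (l i) (l (i + 1)) τ)
    (hp : HasPeriodic (subtractArc i l 2) (subtractArc i l 0) (subtractArc i l 1) (τ - l i)) :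
    HasPeriodic (l 2) (l 0) (l 1) τ := by
  have hi := hp.rotate_all (i := 0) (h.admissible_subtractArc.rotate_all 0) i
  rw [subtractArc_add_two, subtractArc_add_one, subtractArc_self] at hi
  exact (hi.of_renorm h).rotate_all h.admissible 0

theorem HasConnection.subtractArc
    (h : StrictlyRenormalizable (l (i + 2)) (l i) (l (i + 1)) τ) (hne : l (i + 2) ≠ l (i + 1))
    (hl : ∀ k, 0 < l k) (hl' : ∀ k, 0 < subtractArc i l k) (hn₀ : 0 < n)
    (hn : HasConnection (l 2) (l 0) (l 1) τ n) :
    ∃ k < n, 0 < k ∧ HasConnection (_root_.subtractArc i l 2) (_root_.subtractArc i l 0)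
      (_root_.subtractArc i l 1) (τ - l i) k := by
  have hr := h.renormalizable
  obtain ⟨k, hkn, hk₀, hk⟩ :=
    (hn.rotate_all (i := 0) (hr.admissible.rotate_all 0) hl i).renorm h hne hn₀
  rw [← subtractArc_add_two, ← subtractArc_add_one] at hk
  refine ⟨k, hkn, hk₀, rotate_all (i := i) hr.admissible_subtractArc hl' ?_ 0⟩
  rwa [subtractArc_self]

theorem HasRegularInterval.subtractArc (h : Renormalizable (l (i + 2)) (l i) (l (i + 1)) τ)
    (hl : ∀ k, 0 < l k) (hl' : ∀ k, 0 < subtractArc i l k) (hw : 0 < w)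
    (hI : HasRegularInterval (l 2) (l 0) (l 1) τ w) :
    HasRegularInterval (_root_.subtractArc i l 2) (_root_.subtractArc i l 0)
      (_root_.subtractArc i l 1) (τ - l i) w := by
  have hi := (hI.rotate_all (i := 0) (h.admissible.rotate_all 0) hl i).renorm h hw
  rw [← subtractArc_add_two, ← subtractArc_add_one] at hi
  refine rotate_all (i := i) h.admissible_subtractArc hl' ?_ 0
  rwa [subtractArc_self]

end Transfer

section HalfRotation

variable {l : Fin 3 → ℝ} {i : Fin 3} {w : ℝ} {n : ℕ}

theorem half_sum_subtractArc (i : Fin 3) (l : Fin 3 → ℝ) :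
    (∑ k, subtractArc i l k) / 2 = (∑ k, l k) / 2 - l i := by
  rw [sum_subtractArc]
  ring

theorem IsTriangular.strictlyRenormalizable (h : IsTriangular l)
    (h' : IsTriangular (subtractArc i l)) :
    StrictlyRenormalizable (l (i + 2)) (l i) (l (i + 1)) ((∑ k, l k) / 2) := by
  have hpos := h.pos i
  have h₀ := h i
  have h₁ := h (i + 1)
  have h₂ := h (i + 2)
  have hpos₁ := h'.pos (i + 1)
  have hpos₂ := h'.pos (i + 2)
  rw [subtractArc_add_one] at hpos₁
  rw [subtractArc_add_two] at hpos₂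
  rw [sum_eq_add_add l i] at *
  constructor <;> linarith

theorem Inexhaustible.not_hasConnection (h : Inexhaustible l) (hn₀ : 0 < n) :
    ¬HasConnection (l 2) (l 0) (l 1) ((∑ k, l k) / 2) n := by
  induction n using Nat.strong_induction_on generalizing l with
  | _ n ih =>
    intro hn
    obtain ⟨i, hi⟩ := h.exists_subtractArc
    have hne : l (i + 2) ≠ l (i + 1) := h.injective.ne (by fin_cases i <;> decide)
    have hr := h.isTriangular.strictlyRenormalizable hi.isTriangular
    obtain ⟨k, hkn, hk₀, hk⟩ :=
      hn.subtractArc hr hne h.isTriangular.pos hi.isTriangular.pos hn₀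
    rw [← half_sum_subtractArc] at hk
    exact ih k hkn hi hk₀ hk

/-- A regular interval persists through all renormalizations with the same length, while the total
length tends to zero. -/
theorem Inexhaustible.not_hasRegularInterval (h : Inexhaustible l) (hw : 0 < w) :
    ¬HasRegularInterval (l 2) (l 0) (l 1) ((∑ k, l k) / 2) w := by
  obtain ⟨L, j, rfl, h⟩ := h
  intro hI
  have hall (n : ℕ) : HasRegularInterval (L n 2) (L n 0) (L n 1) ((∑ k, L n k) / 2) w := by
    induction n with
    | zero => exact hI
    | succ n ih =>
      have htri := h.isTriangular n
      have htri' := h.isTriangular (n + 1)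
      rw [h.succ] at htri' ⊢
      rw [half_sum_subtractArc]
      exact ih.subtractArc (htri.strictlyRenormalizable htri').renormalizable htri.pos htri'.pos hw
  have hle (n : ℕ) : w ≤ ∑ k, L n k := by
    obtain ⟨x, y, rfl, hxy⟩ := hall n
    obtain ⟨hx, hy⟩ := le_and_le_of_Ioo_subset_regularSet hxy (sub_pos.1 hw)
    rw [Fin.sum_univ_three]
    linarith
  exact hw.not_ge (ge_of_tendsto' h.tendsto_sum hle)

end HalfRotation

section Gasket

variable {l x : Fin 3 → ℝ} {i : Fin 3}

/-- The coordinates in which the subtraction of an arc is a step of the Rauzy algorithm. -/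
noncomputable def rauzyCoord (l : Fin 3 → ℝ) (i : Fin 3) : ℝ := 1 - 2 * l i / ∑ k, l k

theorem rauzyCoord_pos_iff (hl : 0 < ∑ k, l k) : 0 < rauzyCoord l i ↔ 2 * l i < ∑ k, l k := by
  rw [rauzyCoord, sub_pos, div_lt_one hl]

theorem half_lt_rauzyCoord_iff (hl : 0 < ∑ k, l k) :
    1 / 2 < rauzyCoord l i ↔ 4 * l i < ∑ k, l k := by
  rw [rauzyCoord, lt_sub_comm, div_lt_iff₀ hl]
  constructor <;> intro h <;> linarith

theorem sum_rauzyCoord (hl : ∑ k, l k ≠ 0) : ∑ i, rauzyCoord l i = 1 := by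
  simp only [rauzyCoord, Finset.sum_sub_distrib, ← Finset.sum_div, ← Finset.mul_sum]
  rw [mul_div_cancel_right₀ _ hl]
  norm_num

theorem rauzyCoord_subtractArc (hl : ∑ k, l k ≠ 0) (hl' : ∑ k, subtractArc i l k ≠ 0) :
    rauzyCoord (subtractArc i l) = rauzyStep i (rauzyCoord l) := by
  funext k
  rw [sum_subtractArc] at hl'
  have hden : rauzyCoord l i = (∑ k, l k - 2 * l i) / ∑ k, l k := by
    rw [rauzyCoord, sub_div, div_self hl]
  rw [rauzyStep, hden, rauzyCoord, rauzyCoord, sum_subtractArc]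
  split_ifs with hk
  · rw [hk, subtractArc_self]
    field_simp
    ring
  · rw [subtractArc_of_ne hk]
    field_simp
    ring

theorem rauzyStep_pos (hx : ∀ k, 0 < x k) (hi : 1 / 2 < x i) (k : Fin 3) :
    0 < rauzyStep i x k := by
  refine div_pos ?_ (hx i)
  split_ifs
  exacts [by linarith, hx k]

theorem sum_rauzyStep (hx : ∑ k, x k = 1) (hi : x i ≠ 0) : ∑ k, rauzyStep i x k = 1 := by
  simp only [rauzyStep, ← Finset.sum_div]
  rw [div_eq_one_iff_eq hi]
  rw [Fin.sum_univ_three] at hx ⊢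
  fin_cases i <;> simp <;> linarith

theorem exists_rauzyStep_mem_rauzyGasket (hx : x ∈ rauzyGasket) :
    ∃ i, 1 / 2 < x i ∧ rauzyStep i x ∈ rauzyGasket := by
  obtain ⟨hpos, hsum, y, rfl, hy⟩ := hx
  obtain ⟨i, hi, hstep⟩ := hy 0
  exact ⟨i, hi, rauzyStep_pos hpos hi, sum_rauzyStep hsum (hpos i).ne', fun n => y (n + 1), hstep,
    fun n => hy (n + 1)⟩

theorem Inexhaustible.rauzyCoord_mem_rauzyGasket (h : Inexhaustible l) :
    rauzyCoord l ∈ rauzyGasket := by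
  obtain ⟨L, j, rfl, h⟩ := h
  have hs (n : ℕ) := (h.isTriangular n).sum_pos
  refine ⟨fun i => (rauzyCoord_pos_iff (hs 0)).2 (h.isTriangular 0 i), sum_rauzyCoord (hs 0).ne',
    fun n => rauzyCoord (L n), rfl, fun n => ⟨j n, (half_lt_rauzyCoord_iff (hs n)).2 ?_, ?_⟩⟩
  · have hnext := h.isTriangular (n + 1) (j n)
    rw [h.sum_succ, h.succ, subtractArc_self] at hnext
    linarith
  · have hs' := (hs (n + 1)).ne'
    beta_reduce
    rw [h.succ] at hs' ⊢
    exact rauzyCoord_subtractArc (hs n).ne' hs'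

theorem inexhaustible_of_rauzyCoord_mem_rauzyGasket (hl : 0 < ∑ k, l k)
    (h : rauzyCoord l ∈ rauzyGasket) : Inexhaustible l := by
  suffices hP : ∀ m, 0 < ∑ k, m k ∧ rauzyCoord m ∈ rauzyGasket → IsTriangular m ∧
      ∃ i, 0 < ∑ k, subtractArc i m k ∧ rauzyCoord (subtractArc i m) ∈ rauzyGasket by
    obtain ⟨L, j, hL, h, -⟩ := exists_isSubtraction_of_forall_exists hP ⟨hl, h⟩
    exact ⟨L, j, hL, h⟩
  rintro m ⟨hm, hmem⟩
  obtain ⟨i, hi, hstep⟩ := exists_rauzyStep_mem_rauzyGasket hmem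
  rw [half_lt_rauzyCoord_iff hm] at hi
  have htri : IsTriangular m := fun k => (rauzyCoord_pos_iff hm).1 (hmem.1 k)
  have hm' : 0 < ∑ k, subtractArc i m k := by
    rw [sum_subtractArc]
    linarith [htri.pos i]
  exact ⟨htri, i, hm', rauzyCoord_subtractArc hm.ne' hm'.ne' ▸ hstep⟩

theorem inexhaustible_iff_rauzyCoord_mem_rauzyGasket (hl : 0 < ∑ k, l k) :
    Inexhaustible l ↔ rauzyCoord l ∈ rauzyGasket :=
  ⟨Inexhaustible.rauzyCoord_mem_rauzyGasket, inexhaustible_of_rauzyCoord_mem_rauzyGasket hl⟩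

end Gasket

section Aperiodic

variable {a b c τ : ℝ} {l : Fin 3 → ℝ} {i : Fin 3}

theorem hasPeriodic_of_flipMap_eq {x : ℝ} (hx : x ∈ Ico (-a) (b + c)) (h : flipMap a b c τ x = x) :
    HasPeriodic a b c τ :=
  ⟨x, hx, Function.mk_mem_periodicPts one_pos h⟩

theorem Admissible.hasPeriodic_of_rot_lt (h : Admissible a b c τ) (hτ : τ < b) :
    HasPeriodic a b c τ := by
  obtain ⟨ha, -, hc, hτ₀, -⟩ := h
  refine hasPeriodic_of_flipMap_eq (x := (b + τ) / 2) ⟨by linarith, by linarith⟩ ?_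
  rw [flipMap_of_lt (flipArcs_mid ha (by linarith) (by linarith)) (by linarith)]
  ring

theorem Admissible.hasPeriodic_of_lt_rot (h : Admissible a b c τ) (hτ : a + c < τ) :
    HasPeriodic a b c τ := by
  obtain ⟨ha, -, hc, -, hτ'⟩ := h
  refine hasPeriodic_of_flipMap_eq (x := (τ - a - c) / 2) ⟨by linarith, by linarith⟩ ?_
  rw [flipMap_of_le (flipArcs_mid ha (by linarith) (by linarith)) (by linarith)]
  ring

theorem hasPeriodic_of_half (ha : 0 ≤ a) (hc : 0 ≤ c) (hb : 0 < a + c) :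
    HasPeriodic a (a + c) c (a + c) := by
  refine ⟨0, ⟨by linarith, by linarith⟩, 2, two_pos, ?_⟩
  have h₀ : flipArcs a (a + c) c 0 = 0 := flipArcs_of_mem_breaks zero_mem_breaks
  change flipMap a (a + c) c (a + c) (flipMap a (a + c) c (a + c) 0) = 0
  rcases hc.eq_or_lt with rfl | hc
  · rw [flipMap_of_le h₀ (by linarith),
      flipMap_of_lt (flipArcs_of_mem_breaks (mem_breaks.2 (by grind))) (by linarith)]
    ring
  · rw [flipMap_of_lt h₀ (by linarith), zero_add,
      flipMap_of_le (flipArcs_of_mem_breaks right_mem_breaks) (by linarith)]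
    ring

theorem hasPeriodic_of_third (hb : 0 < b) : HasPeriodic b b b b := by
  refine ⟨0, ⟨by linarith, by linarith⟩, 3, three_pos, ?_⟩
  have h₁ : flipMap b b b b 0 = b := by
    rw [flipMap_of_lt (flipArcs_of_mem_breaks zero_mem_breaks) (by linarith), zero_add]
  have h₂ : flipMap b b b b b = -b := by
    rw [flipMap_of_le (flipArcs_of_mem_breaks right_mem_breaks) (by linarith)]
    ring
  have h₃ : flipMap b b b b (-b) = 0 := by
    rw [flipMap_of_lt (flipArcs_of_mem_breaks neg_mem_breaks) (by linarith), neg_add_cancel]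
  change flipMap b b b b (flipMap b b b b (flipMap b b b b 0)) = 0
  rw [h₁, h₂, h₃]

theorem hasPeriodic_of_two_thirds (hb : 0 < b) : HasPeriodic b b b (2 * b) := by
  refine ⟨0, ⟨by linarith, by linarith⟩, 3, three_pos, ?_⟩
  have h₁ : flipMap b b b (2 * b) 0 = -b := by
    rw [flipMap_of_le (flipArcs_of_mem_breaks zero_mem_breaks) (by linarith)]
    ring
  have h₂ : flipMap b b b (2 * b) (-b) = b := by
    rw [flipMap_of_lt (flipArcs_of_mem_breaks neg_mem_breaks) (by linarith)]
    ring
  have h₃ : flipMap b b b (2 * b) b = 0 := by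
    rw [flipMap_of_le (flipArcs_of_mem_breaks right_mem_breaks) (by linarith)]
    ring
  change flipMap b b b _ (flipMap b b b _ (flipMap b b b _ 0)) = 0
  rw [h₁, h₂, h₃]

/-- Nonnegative arcs `l` of positive total length and a rotation `τ` for which the flipped arc
exchange has no periodic point. -/
structure Aperiodic (l : Fin 3 → ℝ) (τ : ℝ) : Prop where
  admissible : Admissible (l 2) (l 0) (l 1) τ
  sum_pos : 0 < ∑ k, l k
  not_hasPeriodic : ¬HasPeriodic (l 2) (l 0) (l 1) τ

theorem Aperiodic.admissible_rotate (h : Aperiodic l τ) (i : Fin 3) :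
    Admissible (l (i + 2)) (l i) (l (i + 1)) τ :=
  h.admissible.rotate_all (i := 0) i

theorem Aperiodic.not_hasPeriodic_rotate (h : Aperiodic l τ) (i : Fin 3) :
    ¬HasPeriodic (l (i + 2)) (l i) (l (i + 1)) τ :=
  fun hp => h.not_hasPeriodic (hp.rotate_all (h.admissible_rotate i) 0)

theorem Aperiodic.le_rot (h : Aperiodic l τ) (i : Fin 3) : l i ≤ τ := by
  by_contra! hτ
  exact h.not_hasPeriodic_rotate i ((h.admissible_rotate i).hasPeriodic_of_rot_lt hτ)

theorem Aperiodic.rot_le (h : Aperiodic l τ) (i : Fin 3) : τ ≤ l (i + 2) + l (i + 1) := by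
  by_contra! hτ
  exact h.not_hasPeriodic_rotate i ((h.admissible_rotate i).hasPeriodic_of_lt_rot hτ)

theorem Aperiodic.isTriangular (h : Aperiodic l τ) : IsTriangular l := by
  intro i
  by_contra! hi
  have hsum := h.sum_pos
  have hle := h.le_rot i
  have hle' := h.rot_le i
  rw [sum_eq_add_add l i] at hi hsum
  have hi : l i = l (i + 2) + l (i + 1) := by linarith
  have hτ : τ = l (i + 2) + l (i + 1) := by linarith
  refine h.not_hasPeriodic_rotate i ?_
  rw [hi, hτ]
  exact hasPeriodic_of_half (h.admissible_rotate i).left_nonneg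
    (h.admissible_rotate i).right_nonneg (by linarith)

theorem Aperiodic.renormalizable_of_forall_le (h : Aperiodic l τ) (hi : ∀ k, l i ≤ l k) :
    Renormalizable (l (i + 2)) (l i) (l (i + 1)) τ := by
  have hpos := h.isTriangular.pos i
  have h₁ := h.rot_le (i + 1)
  have h₂ := h.rot_le (i + 2)
  have e₁ : i + 1 + 2 = i := by fin_cases i <;> rfl
  have e₂ : i + 1 + 1 = i + 2 := by fin_cases i <;> rfl
  have e₃ : i + 2 + 2 = i + 1 := by fin_cases i <;> rfl
  have e₄ : i + 2 + 1 = i := by fin_cases i <;> rfl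
  rw [e₁, e₂] at h₁
  rw [e₃, e₄] at h₂
  have hp := h.not_hasPeriodic_rotate i
  have hi₁ := hi (i + 1)
  have hi₂ := hi (i + 2)
  have hτ₁ := h.le_rot (i + 1)
  have hτ₂ := h.le_rot (i + 2)
  refine ⟨hpos, hi₂, hi₁, hτ₂, hτ₁, by linarith, by linarith, (h.le_rot i).lt_of_ne ?_,
    (h.rot_le i).lt_of_ne ?_⟩
  · rintro rfl
    rw [le_antisymm hτ₁ hi₁, le_antisymm hτ₂ hi₂] at hp
    exact hp (hasPeriodic_of_third hpos)
  · intro hτ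
    have h₁' : l (i + 1) = l i := by linarith
    have h₂' : l (i + 2) = l i := by linarith
    rw [hτ, h₁', h₂', ← two_mul] at hp
    exact hp (hasPeriodic_of_two_thirds hpos)

theorem Aperiodic.exists_subtractArc (h : Aperiodic l τ) :
    ∃ i, Aperiodic (subtractArc i l) (τ - l i) := by
  obtain ⟨i, hi⟩ := Finite.exists_min l
  have hr := h.renormalizable_of_forall_le hi
  refine ⟨i, hr.admissible_subtractArc.rotate_all 0, ?_,
    fun hp => h.not_hasPeriodic (hp.of_subtractArc hr)⟩
  rw [sum_subtractArc]
  exact sub_pos.2 (h.isTriangular i)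

theorem Aperiodic.abs_sum_sub_le (h : Aperiodic l τ) : |∑ k, l k - 2 * τ| ≤ ∑ k, l k := by
  have hadm := h.admissible
  rw [abs_le, Fin.sum_univ_three]
  constructor <;> linarith [hadm.rot_nonneg, hadm.rot_le]

/-- Subtracting an arc from the lengths and from the rotation preserves `∑ k, l k - 2 * τ`, whose
absolute value is at most the total length. -/
theorem Aperiodic.inexhaustible_and_two_mul_eq (h : Aperiodic l τ) :
    Inexhaustible l ∧ 2 * τ = ∑ k, l k := by
  let δ := ∑ k, l k - 2 * τ
  have hstep (m : Fin 3 → ℝ) (hm : ∃ σ, Aperiodic m σ ∧ ∑ k, m k - 2 * σ = δ) :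
      IsTriangular m ∧ ∃ i, ∃ σ, Aperiodic (subtractArc i m) σ ∧
        ∑ k, subtractArc i m k - 2 * σ = δ := by
    obtain ⟨σ, hσ, hδ⟩ := hm
    obtain ⟨i, hi⟩ := hσ.exists_subtractArc
    refine ⟨hσ.isTriangular, i, _, hi, ?_⟩
    rw [sum_subtractArc, ← hδ]
    ring
  obtain ⟨L, j, hL, hsub, hδ⟩ := exists_isSubtraction_of_forall_exists hstep ⟨τ, h, rfl⟩
  have hle (n : ℕ) : |δ| ≤ ∑ k, L n k := by
    obtain ⟨σ, hσ, hδσ⟩ := hδ n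
    exact hδσ ▸ hσ.abs_sum_sub_le
  have hδ₀ : δ = 0 := abs_nonpos_iff.1 (ge_of_tendsto' hsub.tendsto_sum hle)
  exact ⟨⟨L, j, hL, hsub⟩, (sub_eq_zero.1 hδ₀).symm⟩

end Aperiodic

section MinimalityCriterion

/-- The circle map `T` acts as a reflection along every segment avoiding `S`. -/
def IsLocalReflection {L : ℝ} (T : AddCircle L → AddCircle L) (S : Set (AddCircle L)) : Prop :=
  ∀ (p : AddCircle L) (t : ℝ), (∀ s ∈ uIcc 0 t, p + (s : AddCircle L) ∉ S) →
    T (p + (t : AddCircle L)) = T p - (t : AddCircle L)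

/-- The open segment of length `r` issued from `x` in the direction `ε = ±1` avoids `A`. -/
def HasGap {L : ℝ} (A : Set (AddCircle L)) (x : AddCircle L) (ε r : ℝ) : Prop :=
  ∀ t ∈ Ioo 0 r, x + ((ε * t : ℝ) : AddCircle L) ∉ A

variable {L : ℝ} {T : AddCircle L → AddCircle L} {A C S : Set (AddCircle L)} {x p : AddCircle L}
  {ε r s : ℝ}

theorem exists_coe_eq_abs_eq_norm (z : AddCircle L) :
    ∃ t : ℝ, (t : AddCircle L) = z ∧ |t| = ‖z‖ := by
  induction z using QuotientAddGroup.induction_on with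
  | H x =>
    refine ⟨x - round (L⁻¹ * x) * L, ?_, (AddCircle.norm_eq L).symm⟩
    rw [AddCircle.coe_sub, sub_eq_self, AddCircle.coe_eq_zero_iff]
    exact ⟨_, zsmul_eq_mul _ _⟩

theorem eventually_add_coe_notMem (hS : S.Finite) (hp : p ∉ S) :
    ∀ᶠ t : ℝ in 𝓝 0, p + (t : AddCircle L) ∉ S := by
  have hcont : ContinuousAt (fun t : ℝ => p + (t : AddCircle L)) 0 :=
    (continuous_const.add (AddCircle.continuous_mk' L)).continuousAt
  exact hcont.eventually_mem (hS.isClosed.isOpen_compl.mem_nhds (by simpa using hp))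

theorem exists_forall_abs_lt_add_coe_notMem (hS : S.Finite) (hp : p ∉ S) :
    ∃ δ > 0, ∀ t : ℝ, |t| < δ → p + (t : AddCircle L) ∉ S := by
  simpa [Metric.eventually_nhds_iff] using eventually_add_coe_notMem hS hp

theorem abs_le_of_mem_uIcc_zero {t : ℝ} (hs : s ∈ uIcc 0 t) : |s| ≤ |t| := by
  simpa using abs_sub_left_of_mem_uIcc hs

theorem IsLocalReflection.continuousAt (hT : IsLocalReflection T S) (hS : S.Finite)
    (hp : p ∉ S) : ContinuousAt T p := by
  obtain ⟨δ, hδ, hball⟩ := exists_forall_abs_lt_add_coe_notMem hS hp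
  have hreflect : T =ᶠ[𝓝 p] fun z => T p - (z - p) := by
    filter_upwards [Metric.ball_mem_nhds p hδ] with z hz
    obtain ⟨t, ht, htn⟩ := exists_coe_eq_abs_eq_norm (z - p)
    rw [Metric.mem_ball, dist_eq_norm, ← htn] at hz
    rw [← ht, ← hT p t fun s hs => hball s ((abs_le_of_mem_uIcc_zero hs).trans_lt hz), ht,
      add_sub_cancel]
  exact ContinuousAt.congr (by fun_prop) hreflect.symm

theorem HasGap.mono (h : HasGap A x ε r) (hs : s ≤ r) : HasGap A x ε s :=
  fun t ht => h t (Ioo_subset_Ioo_right hs ht)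

theorem exists_pos_hasGap (hS : S.Finite) (hx : x ∉ S) (hε : |ε| = 1) :
    ∃ r > 0, HasGap S x ε r := by
  obtain ⟨δ, hδ, hball⟩ := exists_forall_abs_lt_add_coe_notMem hS hx
  refine ⟨δ, hδ, fun t ht => hball _ ?_⟩
  rw [abs_mul, hε, one_mul, abs_of_pos ht.1]
  exact ht.2

theorem IsLocalReflection.hasGap_map (hT : IsLocalReflection T S)
    (hC : ∀ z, z ∉ S → (T z ∈ C ↔ z ∈ C)) (hx : x ∉ S) (hgapS : HasGap S x ε r)
    (hgapC : HasGap C x ε r) : HasGap C (T x) (-ε) r := by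
  intro t ht
  have hseg : ∀ s ∈ uIcc 0 (ε * t), x + (s : AddCircle L) ∉ S := by
    rw [← mul_zero ε, ← image_const_mul_uIcc, uIcc_of_le ht.1.le]
    rintro _ ⟨u, hu, rfl⟩
    rcases hu.1.eq_or_lt with rfl | hu₀
    · simpa using hx
    · exact hgapS u ⟨hu₀, hu.2.trans_lt ht.2⟩
  rw [neg_mul, AddCircle.coe_neg, ← sub_eq_add_neg, ← hT x _ hseg, hC _ (hgapS t ht)]
  exact hgapC t ht

theorem exists_ne_dist_lt_of_infinite {X : Type*} [PseudoMetricSpace X] [CompactSpace X]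
    {A : Set X} (hA : A.Infinite) (hr : 0 < r) : ∃ x ∈ A, ∃ y ∈ A, x ≠ y ∧ dist x y < r := by
  obtain ⟨F, -, hF, hcover⟩ := finite_cover_balls_of_compact (isCompact_univ (X := X)) (half_pos hr)
  have hnear (x : X) : ∃ c ∈ F, dist x c < r / 2 := by simpa using hcover (mem_univ x)
  choose center hcenter hdist using hnear
  obtain ⟨x, hx, y, hy, hxy, heq⟩ :=
    hA.exists_ne_map_eq_of_mapsTo (fun x _ => hcenter x) hF
  refine ⟨x, hx, y, hy, hxy, ?_⟩
  calc dist x y ≤ dist x (center x) + dist y (center x) := dist_triangle_right _ _ _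
    _ < r / 2 + r / 2 := add_lt_add (hdist x) (heq ▸ hdist y)
    _ = r := add_halves r

theorem finite_setOf_hasGap [Fact (0 < L)] (C : Set (AddCircle L)) (hε : |ε| = 1) (hr : 0 < r) :
    {x ∈ C | HasGap C x ε r}.Finite := by
  by_contra hinf
  obtain ⟨x, ⟨hxC, hx⟩, y, ⟨hyC, hy⟩, hne, hdist⟩ := exists_ne_dist_lt_of_infinite hinf hr
  obtain ⟨t, ht, htn⟩ := exists_coe_eq_abs_eq_norm (y - x)
  have htr : |t| < r := by rwa [htn, ← dist_eq_norm, dist_comm]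
  have ht₀ : 0 < |t| := by rwa [htn, norm_pos_iff, sub_ne_zero, ne_comm]
  have hεt : ε * |t| = t ∨ ε * |t| = -t := by
    rw [← abs_eq_abs, abs_mul, hε, one_mul, abs_abs]
  rcases hεt with h | h
  · exact hx |t| ⟨ht₀, htr⟩ (by rwa [h, ht, add_sub_cancel])
  · exact hy |t| ⟨ht₀, htr⟩ (by rwa [h, AddCircle.coe_neg, ht, neg_sub, add_sub_cancel])

theorem finite_setOf_exists_hasGap_not_hasGap (hS : S.Finite) (C : Set (AddCircle L)) (ε : ℝ) :
    {x ∈ C | ∃ r, HasGap C x ε r ∧ ¬HasGap S x ε r}.Finite := by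
  let blockedBy (σ : AddCircle L) : Set (AddCircle L) :=
    {x ∈ C | ∃ t ≥ 0, x + ((ε * t : ℝ) : AddCircle L) = σ ∧
      ∀ u ∈ Ioc 0 t, x + ((ε * u : ℝ) : AddCircle L) ∉ C}
  have hsub (σ : AddCircle L) : (blockedBy σ).Subsingleton := by
    rintro x ⟨hxC, t, ht, rfl, hx⟩ y ⟨hyC, u, hu, hyx, hy⟩
    have hxy : x = y + ((ε * (u - t) : ℝ) : AddCircle L) := by
      rw [mul_sub, AddCircle.coe_sub, ← add_sub_assoc, hyx, add_sub_cancel_right]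
    have hyx : y = x + ((ε * (t - u) : ℝ) : AddCircle L) := by
      rw [mul_sub, AddCircle.coe_sub, ← add_sub_assoc, ← hyx, add_sub_cancel_right]
    rcases lt_trichotomy t u with htu | rfl | hut
    · exact absurd (hxy ▸ hxC) (hy _ ⟨sub_pos.2 htu, sub_le_self u ht⟩)
    · simpa using hxy
    · exact absurd (hyx ▸ hyC) (hx _ ⟨sub_pos.2 hut, sub_le_self t hu⟩)
  refine (hS.biUnion fun σ _ => (hsub σ).finite).subset ?_
  rintro x ⟨hxC, r, hgap, hS⟩
  simp only [HasGap, not_forall, not_not] at hS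
  obtain ⟨t, ht, htS⟩ := hS
  exact mem_biUnion htS ⟨hxC, t, ht.1.le, rfl, fun u hu => hgap u ⟨hu.1, hu.2.trans_lt ht.2⟩⟩

theorem IsLocalReflection.exists_hasGap_iterate (hT : IsLocalReflection T S) (hS : S.Finite)
    (hC : ∀ z, z ∉ S → (T z ∈ C ↔ z ∈ C)) (horbit : ∀ n, T^[n] x ∉ S) (hε : |ε| = 1) (hr : 0 < r)
    (hgap : HasGap C x ε r) (n : ℕ) : ∃ ε s, |ε| = 1 ∧ 0 < s ∧ HasGap C (T^[n] x) ε s := by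
  induction n with
  | zero => exact ⟨ε, r, hε, hr, hgap⟩
  | succ n ih =>
    obtain ⟨ε, s, hε, hs, hgapC⟩ := ih
    obtain ⟨u, hu, hgapS⟩ := exists_pos_hasGap hS (horbit n) hε
    rw [Function.iterate_succ_apply']
    exact ⟨-ε, min s u, by rwa [abs_neg], lt_min hs hu, hT.hasGap_map hC (horbit n)
      (hgapS.mono (min_le_right s u)) (hgapC.mono (min_le_left s u))⟩

/- A gap is transported along the orbit unless a point of `S` cuts it, and each side of each point
of `S` can cut only one gap of `C`. So from some time on the gaps keep their length, and there are
too many of them for the circle. -/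
theorem IsLocalReflection.not_hasGap [Fact (0 < L)] (hT : IsLocalReflection T S) (hS : S.Finite)
    (hC : ∀ z, z ∉ S → (T z ∈ C ↔ z ∈ C)) (horbit : ∀ n, T^[n] x ∉ S)
    (hinj : Function.Injective fun n => T^[n] x) (hx : x ∈ C) (hε : |ε| = 1) (hr : 0 < r) :
    ¬HasGap C x ε r := by
  intro hgap
  have hdir : {ε : ℝ | |ε| = 1}.Finite :=
    (toFinite {1, -1}).subset fun ε hε => eq_or_eq_neg_of_abs_eq hε
  have hmem (n : ℕ) : T^[n] x ∈ C := by
    induction n with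
    | zero => exact hx
    | succ n ih =>
      rw [Function.iterate_succ_apply']
      exact (hC _ (horbit n)).2 ih
  have hfin : {z | ∃ ε : ℝ, |ε| = 1 ∧ z ∈ C ∧ ∃ r, HasGap C z ε r ∧ ¬HasGap S z ε r}.Finite := by
    refine (hdir.biUnion fun ε _ => finite_setOf_exists_hasGap_not_hasGap hS C ε).subset ?_
    rintro z ⟨ε, hε, hz⟩
    exact mem_biUnion hε hz
  obtain ⟨N, hN⟩ := (hfin.preimage hinj.injOn).bddAbove
  obtain ⟨ε, s, hε, hs, hgap⟩ := hT.exists_hasGap_iterate hS hC horbit hε hr hgap (N + 1)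
  have hpersist (k : ℕ) : ∃ ε, |ε| = 1 ∧ HasGap C (T^[N + 1 + k] x) ε s := by
    induction k with
    | zero => exact ⟨ε, hε, hgap⟩
    | succ k ih =>
      obtain ⟨ε, hε, hgapC⟩ := ih
      have hgapS : HasGap S (T^[N + 1 + k] x) ε s := by
        by_contra hcut
        have := hN ⟨ε, hε, hmem _, s, hgapC, hcut⟩
        lia
      rw [← add_assoc, Function.iterate_succ_apply']
      exact ⟨-ε, by rwa [abs_neg], hT.hasGap_map hC (horbit _) hgapS hgapC⟩
  refine infinite_of_injective_forall_mem (hinj.comp (add_right_injective (N + 1)))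
    (fun k => ?_) (hdir.biUnion fun ε hε => finite_setOf_hasGap C hε hs)
  obtain ⟨ε, hε, hgap⟩ := hpersist k
  exact mem_biUnion hε ⟨hmem _, hgap⟩

theorem IsLocalReflection.iterate_add_coe (hT : IsLocalReflection T S)
    (havoid : ∀ k (s : ℝ), |s| < r → T^[k] x + (s : AddCircle L) ∉ S) {t : ℝ} (ht : |t| < r)
    (k : ℕ) : T^[k] (x + (t : AddCircle L)) = T^[k] x + (((-1) ^ k * t : ℝ) : AddCircle L) := by
  induction k with
  | zero => simp
  | succ k ih =>
    have hseg : ∀ s ∈ uIcc 0 ((-1) ^ k * t), T^[k] x + (s : AddCircle L) ∉ S := fun s hs =>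
      havoid k s (((abs_le_of_mem_uIcc_zero hs).trans_eq (by simp [abs_mul])).trans_lt ht)
    rw [Function.iterate_succ_apply', ih, hT _ _ hseg, Function.iterate_succ_apply', pow_succ',
      neg_one_mul, neg_mul, AddCircle.coe_neg, sub_eq_add_neg]

theorem iterate_notMem_of_isPeriodicPt {X : Type*} {f : X → X} {S : Set X} {x : X} {n : ℕ}
    (hconn : ∀ σ ∈ S, ∀ n > 0, f^[n] σ ∉ S) (hn : 0 < n) (hx : Function.IsPeriodicPt f n x)
    (k : ℕ) : f^[k] x ∉ S := by
  intro hk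
  have hperiodic : f^[n] (f^[k] x) = f^[k] x := hx.apply_iterate k
  exact hconn _ hk n hn (by rwa [hperiodic])

theorem IsLocalReflection.notMem_periodicPts (hT : IsLocalReflection T S) (hS : S.Finite)
    (hconn : ∀ σ ∈ S, ∀ n > 0, T^[n] σ ∉ S)
    (hreg : ∀ x (r : ℝ), 0 < r → ∃ t ∈ Ioo 0 r, ∃ n, T^[n] (x + (t : AddCircle L)) ∈ S)
    (x : AddCircle L) : x ∉ Function.periodicPts T := by
  rintro ⟨n, hn, hper⟩
  have horbit : ∀ᶠ t : ℝ in 𝓝 0, ∀ k ∈ Finset.range n, T^[k] x + (t : AddCircle L) ∉ S :=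
    (Filter.eventually_all_finset _).2 fun k _ =>
      eventually_add_coe_notMem hS (iterate_notMem_of_isPeriodicPt hconn hn hper k)
  obtain ⟨δ, hδ, hball⟩ := Metric.eventually_nhds_iff.1 horbit
  have havoid (k : ℕ) (s : ℝ) (hs : |s| < δ) : T^[k] x + (s : AddCircle L) ∉ S := by
    rw [← hper.iterate_mod_apply k]
    exact hball (by rwa [Real.dist_eq, sub_zero]) _ (Finset.mem_range.2 (Nat.mod_lt k hn))
  obtain ⟨t, ht, k, hk⟩ := hreg x δ hδ
  have htδ : |t| < δ := by rw [abs_of_pos ht.1]; exact ht.2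
  rw [hT.iterate_add_coe havoid htδ] at hk
  exact havoid k _ (by simpa [abs_mul] using htδ) hk

theorem injective_iterate_of_notMem_periodicPts {X : Type*} {f : X → X}
    (hf : Function.Injective f) {x : X} (hx : x ∉ Function.periodicPts f) :
    Function.Injective fun n => f^[n] x := by
  refine Function.Injective.of_lt_imp_ne fun m n hmn heq => hx ?_
  exact Function.mk_mem_periodicPts (Nat.sub_pos_of_lt hmn) (Function.iterate_cancel hf heq.symm)

theorem exists_hasGap_of_isClosed [Fact (0 < L)] (hC : IsClosed C) (hne : C.Nonempty)
    (huniv : C ≠ univ) : ∃ x ∈ C, ∃ r > 0, HasGap C x 1 r := by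
  obtain ⟨c, hc⟩ := hne
  obtain ⟨z, hz⟩ := (ne_univ_iff_exists_notMem C).1 huniv
  let A : Set ℝ := {t | 0 ≤ t ∧ z - (t : AddCircle L) ∈ C}
  have hclosed : IsClosed A :=
    isClosed_Ici.inter (hC.preimage (continuous_const.sub (AddCircle.continuous_mk' L)))
  have hbdd : BddBelow A := ⟨0, fun t ht => ht.1⟩
  have hnonempty : A.Nonempty := by
    obtain ⟨t, ht, hzt⟩ := AddCircle.eq_coe_Ico (z - c)
    exact ⟨t, ht.1, by rwa [hzt, sub_sub_cancel]⟩
  obtain ⟨hinf₀, hinfC⟩ := hclosed.csInf_mem hnonempty hbdd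
  refine ⟨_, hinfC, sInf A, hinf₀.lt_of_ne fun h => hz ?_, fun t ht htC => ?_⟩
  · simpa [← h] using hinfC
  · have htA : sInf A - t ∈ A := by
      refine ⟨sub_nonneg.2 ht.2.le, ?_⟩
      rw [one_mul] at htC
      rwa [AddCircle.coe_sub, ← sub_add]
    linarith [csInf_le hbdd htA, ht.1]

theorem mapClusterPt_add_one_iff {X : Type*} [TopologicalSpace X] {u : ℕ → X} {z : X} :
    MapClusterPt z atTop (fun n => u (n + 1)) ↔ MapClusterPt z atTop u := by
  rw [MapClusterPt, ← Function.comp_def u, ← Filter.map_map, map_add_atTop_eq_nat, MapClusterPt]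

theorem mapClusterPt_iterate_apply {X : Type*} [TopologicalSpace X] {f : X → X} {p z : X}
    (hf : ContinuousAt f z) (hz : MapClusterPt z atTop fun n => f^[n] p) :
    MapClusterPt (f z) atTop fun n => f^[n] p := by
  rw [← mapClusterPt_add_one_iff]
  simpa only [Function.comp_def, Function.iterate_succ_apply'] using
    MapClusterPt.continuousAt_comp hf hz

theorem mapClusterPt_iterate_symm_apply {X : Type*} [TopologicalSpace X] {e : X ≃ X} {p z : X}
    (he : ContinuousAt e.symm z) (hz : MapClusterPt z atTop fun n => e^[n] p) :
    MapClusterPt (e.symm z) atTop fun n => e^[n] p := by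
  rw [← mapClusterPt_add_one_iff] at hz
  simpa only [Function.comp_def, Function.iterate_succ_apply', Equiv.symm_apply_apply] using
    MapClusterPt.continuousAt_comp he hz

theorem forall_iterate_notMem_or {X : Type*} {e : X ≃ X} {S : Set X}
    (hconn : ∀ σ ∈ S, ∀ n > 0, e^[n] σ ∉ S) (x : X) :
    (∀ n, e^[n] x ∉ S) ∨ ∀ n, e.symm^[n] x ∉ e '' S := by
  by_contra! hcon
  obtain ⟨⟨n, hn⟩, m, σ, hσ, hm⟩ := hcon
  have hinv : e^[m] (e.symm^[m] x) = x := (e.right_inv.iterate m) x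
  refine hconn σ hσ (n + m + 1) (Nat.succ_pos _) ?_
  rwa [Function.iterate_succ_apply, hm, Function.iterate_add_apply, hinv]

theorem notMem_periodicPts_symm {X : Type*} {e : X ≃ X} {x : X}
    (hx : x ∉ Function.periodicPts e) : x ∉ Function.periodicPts e.symm := by
  rintro ⟨n, hn, h⟩
  refine hx ⟨n, hn, ?_⟩
  have hinv : e^[n] (e.symm^[n] x) = x := (e.right_inv.iterate n) x
  rwa [h.eq] at hinv

section Equiv

variable [Fact (0 < L)] {T : AddCircle L ≃ AddCircle L}

theorem IsLocalReflection.eq_univ_of_isClosed (hS : S.Finite) (hT : IsLocalReflection T S)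
    (hT' : IsLocalReflection T.symm (T '' S)) (hconn : ∀ σ ∈ S, ∀ n > 0, T^[n] σ ∉ S)
    (hper : ∀ x, x ∉ Function.periodicPts T) (hclosed : IsClosed C) (hne : C.Nonempty)
    (hC : ∀ z, z ∉ S → (T z ∈ C ↔ z ∈ C)) : C = univ := by
  by_contra huniv
  obtain ⟨x, hx, r, hr, hgap⟩ := exists_hasGap_of_isClosed hclosed hne huniv
  rcases forall_iterate_notMem_or hconn x with hfwd | hbwd
  · exact hT.not_hasGap hS hC hfwd (injective_iterate_of_notMem_periodicPts T.injective (hper x))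
      hx abs_one hr hgap
  · have hC' (z : AddCircle L) (hz : z ∉ T '' S) : T.symm z ∈ C ↔ z ∈ C := by
      rw [← hC _ (fun h => hz ⟨_, h, T.apply_symm_apply z⟩), T.apply_symm_apply]
    exact hT'.not_hasGap (hS.image T) hC' hbwd (injective_iterate_of_notMem_periodicPts
      T.symm.injective (notMem_periodicPts_symm (hper x))) hx abs_one hr hgap

theorem IsLocalReflection.isMinimalMap (hS : S.Finite) (hT : IsLocalReflection T S)
    (hT' : IsLocalReflection T.symm (T '' S)) (hconn : ∀ σ ∈ S, ∀ n > 0, T^[n] σ ∉ S)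
    (hreg : ∀ x (r : ℝ), 0 < r → ∃ t ∈ Ioo 0 r, ∃ n, T^[n] (x + (t : AddCircle L)) ∈ S) :
    IsMinimalMap T := by
  intro p z
  let C : Set (AddCircle L) := {z | MapClusterPt z atTop fun n => T^[n] p}
  have hC (z : AddCircle L) (hz : z ∉ S) : T z ∈ C ↔ z ∈ C := by
    refine ⟨fun h => ?_, mapClusterPt_iterate_apply (hT.continuousAt hS hz)⟩
    have hTz : T z ∉ T '' S := by rwa [T.injective.mem_set_image]
    rw [← T.symm_apply_apply z]
    exact mapClusterPt_iterate_symm_apply (hT'.continuousAt (hS.image T) hTz) h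
  have huniv : C = univ := hT.eq_univ_of_isClosed hS hT' hconn
    (hT.notMem_periodicPts hS hconn hreg) isClosed_setOfPred_clusterPt
    (exists_clusterPt_of_compactSpace _) hC
  have hz : z ∈ C := huniv ▸ mem_univ z
  exact mem_closure_iff_clusterPt.2 (ClusterPt.mono hz (le_principal_iff.2 range_mem_map))

end Equiv

end MinimalityCriterion

section CircleExchange

theorem arcFlip_coe_of_mem {u v x : ℝ} (hx : x ∈ Ioo u v) :
    arcFlip u v (x : UnitAddCircle) = ((u + v - x : ℝ) : UnitAddCircle) := by
  rw [arcFlip, if_pos ⟨x, hx, rfl⟩, ← AddCircle.coe_sub]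

theorem arcFlip_coe_of_notMem {u v x : ℝ} (hu : 0 ≤ u) (hv : v ≤ 1) (hx : x ∈ Ico (0 : ℝ) 1)
    (hxuv : x ∉ Ioo u v) : arcFlip u v (x : UnitAddCircle) = x := by
  refine if_neg ?_
  rintro ⟨t, ht, htx⟩
  have ht₀ : t ∈ Ico (0 : ℝ) (0 + 1) := ⟨hu.trans ht.1.le, by linarith [ht.2]⟩
  rw [← zero_add (1 : ℝ)] at hx
  exact hxuv ((AddCircle.coe_eq_coe_iff_of_mem_Ico ht₀ hx).1 htx ▸ ht)

variable {l : Fin 3 → ℝ} {x t : ℝ} {p τ : UnitAddCircle}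

theorem sum_three_of_mem_stdSimplex (hl : l ∈ stdSimplex ℝ (Fin 3)) : l 0 + l 1 + l 2 = 1 := by
  rw [← Fin.sum_univ_three, hl.2]

theorem cetInvolution_coe_first (hl : l ∈ stdSimplex ℝ (Fin 3)) (hx : x ∈ Ioo 0 (l 0)) :
    cetInvolution l (x : UnitAddCircle) = ((l 0 - x : ℝ) : UnitAddCircle) := by
  have hsum := sum_three_of_mem_stdSimplex hl
  obtain ⟨h₀, h₁, h₂⟩ : 0 ≤ l 0 ∧ 0 ≤ l 1 ∧ 0 ≤ l 2 := ⟨hl.1 0, hl.1 1, hl.1 2⟩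
  have hx' : l 0 - x ∈ Ico (0 : ℝ) 1 := ⟨by linarith [hx.2], by linarith [hx.1]⟩
  simp only [cetInvolution, Function.comp_apply]
  rw [arcFlip_coe_of_mem hx, zero_add,
    arcFlip_coe_of_notMem h₀ (by linarith) hx' fun h => by linarith [h.1, hx.1],
    arcFlip_coe_of_notMem (by linarith) hsum.le hx' fun h => by linarith [h.1, hx.1]]

theorem cetInvolution_coe_second (hl : l ∈ stdSimplex ℝ (Fin 3))
    (hx : x ∈ Ioo (l 0) (l 0 + l 1)) :
    cetInvolution l (x : UnitAddCircle) = ((2 * l 0 + l 1 - x : ℝ) : UnitAddCircle) := by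
  have hsum := sum_three_of_mem_stdSimplex hl
  obtain ⟨h₀, h₁, h₂⟩ : 0 ≤ l 0 ∧ 0 ≤ l 1 ∧ 0 ≤ l 2 := ⟨hl.1 0, hl.1 1, hl.1 2⟩
  have hx₀ : x ∈ Ico (0 : ℝ) 1 := ⟨by linarith [hx.1], by linarith [hx.2]⟩
  have hx' : 2 * l 0 + l 1 - x ∈ Ico (0 : ℝ) 1 := ⟨by linarith [hx.2], by linarith [hx.1]⟩
  simp only [cetInvolution, Function.comp_apply]
  rw [arcFlip_coe_of_notMem le_rfl (by linarith) hx₀ fun h => by linarith [h.2, hx.1],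
    arcFlip_coe_of_mem hx, ← add_assoc, ← two_mul,
    arcFlip_coe_of_notMem (by linarith) hsum.le hx' fun h => by linarith [h.1, hx.1]]

theorem cetInvolution_coe_third (hl : l ∈ stdSimplex ℝ (Fin 3)) (hx : x ∈ Ioo (l 0 + l 1) 1) :
    cetInvolution l (x : UnitAddCircle) = ((l 0 + l 1 + 1 - x : ℝ) : UnitAddCircle) := by
  have hsum := sum_three_of_mem_stdSimplex hl
  obtain ⟨h₀, h₁, h₂⟩ : 0 ≤ l 0 ∧ 0 ≤ l 1 ∧ 0 ≤ l 2 := ⟨hl.1 0, hl.1 1, hl.1 2⟩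
  have hx₀ : x ∈ Ico (0 : ℝ) 1 := ⟨by linarith [hx.1], hx.2⟩
  simp only [cetInvolution, Function.comp_apply]
  rw [arcFlip_coe_of_notMem le_rfl (by linarith) hx₀ fun h => by linarith [h.2, hx.1],
    arcFlip_coe_of_notMem h₀ (by linarith) hx₀ fun h => by linarith [h.2, hx.1], hsum,
    arcFlip_coe_of_mem hx]

theorem cetInvolution_coe_endpoint (hl : l ∈ stdSimplex ℝ (Fin 3)) (hx : x ∈ Ico (0 : ℝ) 1)
    (hend : x = 0 ∨ x = l 0 ∨ x = l 0 + l 1) : cetInvolution l (x : UnitAddCircle) = x := by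
  have hsum := sum_three_of_mem_stdSimplex hl
  obtain ⟨h₀, h₁, h₂⟩ : 0 ≤ l 0 ∧ 0 ≤ l 1 ∧ 0 ≤ l 2 := ⟨hl.1 0, hl.1 1, hl.1 2⟩
  simp only [cetInvolution, Function.comp_apply]
  rw [arcFlip_coe_of_notMem le_rfl (by linarith) hx ?_,
    arcFlip_coe_of_notMem h₀ (by linarith) hx ?_,
    arcFlip_coe_of_notMem (by linarith) hsum.le hx ?_] <;>
  · rintro ⟨hx₁, hx₂⟩
    rcases hend with h | h | h <;> linarith

theorem cetInvolution_coe (hl : l ∈ stdSimplex ℝ (Fin 3)) (hx : x ∈ Ico (-l 2) (l 0 + l 1)) :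
    cetInvolution l (x : UnitAddCircle) = (flipArcs (l 2) (l 0) (l 1) x : UnitAddCircle) := by
  have hsum := sum_three_of_mem_stdSimplex hl
  obtain ⟨h₀, h₁, h₂⟩ : 0 ≤ l 0 ∧ 0 ≤ l 1 ∧ 0 ≤ l 2 := ⟨hl.1 0, hl.1 1, hl.1 2⟩
  rcases lt_or_ge x 0 with hneg | hpos
  · rw [← AddCircle.coe_add_period (1 : ℝ) x]
    rcases hx.1.eq_or_lt with rfl | hlt
    · rw [flipArcs_of_mem_breaks neg_mem_breaks, cetInvolution_coe_endpoint hl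
        ⟨by linarith, by linarith⟩ (.inr (.inr (by linarith))), AddCircle.coe_add_period]
    · rw [flipArcs_left h₀ hlt hneg, cetInvolution_coe_third hl ⟨by linarith, by linarith⟩,
        ← AddCircle.coe_add_period (1 : ℝ) (-l 2 - x)]
      congr 1
      linarith
  have hx₁ : x ∈ Ico (0 : ℝ) 1 := ⟨hpos, by linarith [hx.2]⟩
  rcases hpos.eq_or_lt with rfl | hpos
  · rw [flipArcs_of_mem_breaks zero_mem_breaks, cetInvolution_coe_endpoint hl hx₁ (.inl rfl)]
  rcases lt_trichotomy x (l 0) with hlt | rfl | hgt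
  · rw [flipArcs_mid h₂ hpos hlt, cetInvolution_coe_first hl ⟨hpos, hlt⟩]
  · rw [flipArcs_of_mem_breaks right_mem_breaks,
      cetInvolution_coe_endpoint hl hx₁ (.inr (.inl rfl))]
  · rw [flipArcs_right h₂ h₀ hgt, cetInvolution_coe_second hl ⟨hgt, hx.2⟩]

theorem cetMap_coe (hl : l ∈ stdSimplex ℝ (Fin 3)) (hx : x ∈ Ico (-l 2) (l 0 + l 1)) :
    cetMap l t (x : UnitAddCircle) = (flipMap (l 2) (l 0) (l 1) t x : UnitAddCircle) := by
  have hperiod : l 2 + l 0 + l 1 = 1 := by linarith [sum_three_of_mem_stdSimplex hl]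
  rw [cetMap, cetInvolution_coe hl hx, ← AddCircle.coe_add, flipMap, hperiod]
  split_ifs
  · rfl
  · rw [AddCircle.coe_sub, AddCircle.coe_period, sub_zero]

theorem admissible_of_mem_stdSimplex (hl : l ∈ stdSimplex ℝ (Fin 3)) (ht : t ∈ Icc (0 : ℝ) 1) :
    Admissible (l 2) (l 0) (l 1) t :=
  ⟨hl.1 2, hl.1 0, hl.1 1, ht.1, by linarith [sum_three_of_mem_stdSimplex hl, ht.2]⟩

theorem cetMap_iterate_coe (hl : l ∈ stdSimplex ℝ (Fin 3)) (ht : t ∈ Icc (0 : ℝ) 1)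
    (hx : x ∈ Ico (-l 2) (l 0 + l 1)) (n : ℕ) :
    (cetMap l t)^[n] (x : UnitAddCircle) =
      ((flipMap (l 2) (l 0) (l 1) t)^[n] x : UnitAddCircle) := by
  induction n with
  | zero => rfl
  | succ n ih =>
    have hmaps := (admissible_of_mem_stdSimplex hl ht).mapsTo_flipMap
    rw [Function.iterate_succ_apply', Function.iterate_succ_apply', ih,
      cetMap_coe hl (hmaps.iterate n hx)]

theorem exists_mem_Ico_coe_eq (hl : l ∈ stdSimplex ℝ (Fin 3)) (p : UnitAddCircle) :
    ∃ x ∈ Ico (-l 2) (l 0 + l 1), (x : UnitAddCircle) = p := by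
  have hend : -l 2 + 1 = l 0 + l 1 := by linarith [sum_three_of_mem_stdSimplex hl]
  have hp : p ∈ ((↑) : ℝ → UnitAddCircle) '' Ico (-l 2) (-l 2 + 1) :=
    AddCircle.coe_image_Ico_eq (1 : ℝ) (-l 2) ▸ mem_univ p
  rwa [hend] at hp

/-- The endpoints of the three arcs exchanged by `cetMap l`, seen on the circle. -/
def cetBreaks (l : Fin 3 → ℝ) : Set UnitAddCircle :=
  (↑) '' breaks (l 2) (l 0)

theorem finite_cetBreaks (l : Fin 3 → ℝ) : (cetBreaks l).Finite :=
  (toFinite ({-l 2, 0, l 0} : Set ℝ)).image _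

theorem coe_right_end (hl : l ∈ stdSimplex ℝ (Fin 3)) :
    ((l 0 + l 1 : ℝ) : UnitAddCircle) = ((-l 2 : ℝ) : UnitAddCircle) := by
  rw [← AddCircle.coe_add_period (1 : ℝ) (-l 2)]
  congr 1
  linarith [sum_three_of_mem_stdSimplex hl]

theorem exists_mem_breaks_coe_eq (hl : l ∈ stdSimplex ℝ (Fin 3)) (hp : p ∈ cetBreaks l) :
    ∃ x ∈ breaks (l 2) (l 0), x ∈ Ico (-l 2) (l 0 + l 1) ∧ (x : UnitAddCircle) = p := by
  have hsum := sum_three_of_mem_stdSimplex hl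
  obtain ⟨h₀, h₁, h₂⟩ : 0 ≤ l 0 ∧ 0 ≤ l 1 ∧ 0 ≤ l 2 := ⟨hl.1 0, hl.1 1, hl.1 2⟩
  obtain ⟨y, hy, rfl⟩ := hp
  have hIcc : y ∈ Icc (-l 2) (l 0 + l 1) := by
    rcases hy with rfl | rfl | rfl <;> constructor <;> linarith
  rcases hIcc.2.eq_or_lt with rfl | hlt
  · exact ⟨-l 2, neg_mem_breaks, ⟨le_rfl, by linarith⟩, (coe_right_end hl).symm⟩
  · exact ⟨y, hy, ⟨hIcc.1, hlt⟩, rfl⟩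

theorem coe_mem_cetBreaks_iff (hl : l ∈ stdSimplex ℝ (Fin 3)) (hx : x ∈ Ico (-l 2) (l 0 + l 1)) :
    (x : UnitAddCircle) ∈ cetBreaks l ↔ x ∈ breaks (l 2) (l 0) := by
  refine ⟨fun h => ?_, fun h => ⟨x, h, rfl⟩⟩
  obtain ⟨y, hy, hyIco, hyx⟩ := exists_mem_breaks_coe_eq hl h
  have hend : l 0 + l 1 = -l 2 + 1 := by linarith [sum_three_of_mem_stdSimplex hl]
  rw [hend] at hx hyIco
  exact (AddCircle.coe_eq_coe_iff_of_mem_Ico hyIco hx).1 hyx ▸ hy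

theorem cetInvolution_of_mem_cetBreaks (hl : l ∈ stdSimplex ℝ (Fin 3)) (hp : p ∈ cetBreaks l) :
    cetInvolution l p = p := by
  obtain ⟨x, hx, hxIco, rfl⟩ := exists_mem_breaks_coe_eq hl hp
  rw [cetInvolution_coe hl hxIco, flipArcs_of_mem_breaks hx]

theorem exists_arc_of_notMem_cetBreaks (hl : l ∈ stdSimplex ℝ (Fin 3)) (hp : p ∉ cetBreaks l) :
    ∃ u v : ℝ, (u : UnitAddCircle) ∈ cetBreaks l ∧ (v : UnitAddCircle) ∈ cetBreaks l ∧
      (∃ x ∈ Ioo u v, (x : UnitAddCircle) = p) ∧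
      ∀ y ∈ Ioo u v, cetInvolution l (y : UnitAddCircle) = ((u + v - y : ℝ) : UnitAddCircle) := by
  obtain ⟨h₀, h₁, h₂⟩ : 0 ≤ l 0 ∧ 0 ≤ l 1 ∧ 0 ≤ l 2 := ⟨hl.1 0, hl.1 1, hl.1 2⟩
  obtain ⟨x, hx, rfl⟩ := exists_mem_Ico_coe_eq hl p
  rw [coe_mem_cetBreaks_iff hl hx, mem_breaks] at hp
  push Not at hp
  obtain ⟨hx₁, hx₂, hx₃⟩ := hp
  have hleft : ((-l 2 : ℝ) : UnitAddCircle) ∈ cetBreaks l := ⟨_, neg_mem_breaks, rfl⟩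
  have hzero : ((0 : ℝ) : UnitAddCircle) ∈ cetBreaks l := ⟨_, zero_mem_breaks, rfl⟩
  have hmid : ((l 0 : ℝ) : UnitAddCircle) ∈ cetBreaks l := ⟨_, right_mem_breaks, rfl⟩
  rcases hx₂.lt_or_gt with hneg | hpos
  · refine ⟨-l 2, 0, hleft, hzero, ⟨x, ⟨hx.1.lt_of_ne' hx₁, hneg⟩, rfl⟩, fun y hy => ?_⟩
    rw [cetInvolution_coe hl ⟨hy.1.le, by linarith [hy.2]⟩, flipArcs_left h₀ hy.1 hy.2, add_zero]
  rcases hx₃.lt_or_gt with hlt | hgt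
  · refine ⟨0, l 0, hzero, hmid, ⟨x, ⟨hpos, hlt⟩, rfl⟩, fun y hy => ?_⟩
    rw [cetInvolution_coe hl ⟨by linarith [hy.1], by linarith [hy.2]⟩,
      flipArcs_mid h₂ hy.1 hy.2, zero_add]
  · refine ⟨l 0, l 0 + l 1, hmid, coe_right_end hl ▸ hleft, ⟨x, ⟨hgt, hx.2⟩, rfl⟩, fun y hy => ?_⟩
    rw [cetInvolution_coe hl ⟨by linarith [hy.1], hy.2⟩, flipArcs_right h₂ h₀ hy.1, two_mul,
      add_assoc]

theorem involutive_cetInvolution (hl : l ∈ stdSimplex ℝ (Fin 3)) :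
    Function.Involutive (cetInvolution l) := by
  intro p
  by_cases hp : p ∈ cetBreaks l
  · rw [cetInvolution_of_mem_cetBreaks hl hp, cetInvolution_of_mem_cetBreaks hl hp]
  · obtain ⟨u, v, -, -, ⟨x, hx, rfl⟩, harc⟩ := exists_arc_of_notMem_cetBreaks hl hp
    rw [harc x hx, harc _ ⟨by linarith [hx.2], by linarith [hx.1]⟩, sub_sub_cancel]

theorem isLocalReflection_cetInvolution (hl : l ∈ stdSimplex ℝ (Fin 3)) :
    IsLocalReflection (cetInvolution l) (cetBreaks l) := by
  intro p t hseg
  have hp : p ∉ cetBreaks l := by simpa using hseg 0 left_mem_uIcc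
  obtain ⟨u, v, hu, hv, ⟨x, hx, rfl⟩, harc⟩ := exists_arc_of_notMem_cetBreaks hl hp
  have hsegment (e : ℝ) (he : (e : UnitAddCircle) ∈ cetBreaks l) : e - x ∉ uIcc 0 t := fun h =>
    hseg _ h (by rwa [← AddCircle.coe_add, add_sub_cancel])
  have hxt : x + t ∈ Ioo u v := by
    have hu' := hsegment u hu
    have hv' := hsegment v hv
    rw [mem_uIcc] at hu' hv'
    grind
  rw [← AddCircle.coe_add, harc _ hxt, harc _ hx, ← AddCircle.coe_sub, sub_sub]

/-- `cetMap` as a permutation of the circle. -/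
noncomputable def cetEquiv (hl : l ∈ stdSimplex ℝ (Fin 3)) (τ : UnitAddCircle) :
    UnitAddCircle ≃ UnitAddCircle :=
  (involutive_cetInvolution hl).toPerm.trans (Equiv.addRight τ)

theorem coe_cetEquiv (hl : l ∈ stdSimplex ℝ (Fin 3)) (τ : UnitAddCircle) :
    ⇑(cetEquiv hl τ) = cetMap l τ := rfl

theorem isLocalReflection_cetEquiv (hl : l ∈ stdSimplex ℝ (Fin 3)) (τ : UnitAddCircle) :
    IsLocalReflection (cetEquiv hl τ) (cetBreaks l) := by
  intro p t hseg
  rw [coe_cetEquiv, cetMap, cetMap, isLocalReflection_cetInvolution hl p t hseg,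
    sub_add_eq_add_sub]

theorem isLocalReflection_cetEquiv_symm (hl : l ∈ stdSimplex ℝ (Fin 3)) (τ : UnitAddCircle) :
    IsLocalReflection (cetEquiv hl τ).symm (cetEquiv hl τ '' cetBreaks l) := by
  intro p t hseg
  have hsymm (q : UnitAddCircle) : (cetEquiv hl τ).symm q = cetInvolution l (q - τ) := by
    rw [sub_eq_add_neg]; rfl
  rw [hsymm, hsymm, add_sub_right_comm]
  refine isLocalReflection_cetInvolution hl _ t fun s hs hmem => hseg s hs ⟨_, hmem, ?_⟩
  rw [coe_cetEquiv, cetMap, cetInvolution_of_mem_cetBreaks hl hmem, ← add_sub_right_comm,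
    sub_add_cancel]

theorem cetMap_iterate_coe_mem_cetBreaks_iff (hl : l ∈ stdSimplex ℝ (Fin 3))
    (ht : t ∈ Icc (0 : ℝ) 1) (hx : x ∈ Ico (-l 2) (l 0 + l 1)) (n : ℕ) :
    (cetMap l t)^[n] (x : UnitAddCircle) ∈ cetBreaks l ↔
      (flipMap (l 2) (l 0) (l 1) t)^[n] x ∈ breaks (l 2) (l 0) := by
  rw [cetMap_iterate_coe hl ht hx, coe_mem_cetBreaks_iff hl
    ((admissible_of_mem_stdSimplex hl ht).mapsTo_flipMap.iterate n hx)]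

theorem hasConnection_of_cetMap_iterate_mem (hl : l ∈ stdSimplex ℝ (Fin 3))
    (ht : t ∈ Icc (0 : ℝ) 1) (hp : p ∈ cetBreaks l) {n : ℕ}
    (hn : (cetMap l t)^[n] p ∈ cetBreaks l) : HasConnection (l 2) (l 0) (l 1) t n := by
  obtain ⟨x, hx, hxIco, rfl⟩ := exists_mem_breaks_coe_eq hl hp
  exact ⟨x, hx, (cetMap_iterate_coe_mem_cetBreaks_iff hl ht hxIco n).1 hn⟩

theorem exists_hasRegularInterval_of_cetMap_iterate_notMem (hl : l ∈ stdSimplex ℝ (Fin 3))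
    (ht : t ∈ Icc (0 : ℝ) 1) {r : ℝ} (hr : 0 < r)
    (havoid : ∀ s ∈ Ioo 0 r, ∀ n, (cetMap l t)^[n] (p + (s : UnitAddCircle)) ∉ cetBreaks l) :
    ∃ w > 0, HasRegularInterval (l 2) (l 0) (l 1) t w := by
  obtain ⟨x, hx, rfl⟩ := exists_mem_Ico_coe_eq hl p
  refine ⟨_, sub_pos.2 (lt_min (lt_add_of_pos_right x hr) hx.2), x, min (x + r) (l 0 + l 1), rfl,
    fun y hy => ?_⟩
  obtain ⟨hyr, hyl⟩ := lt_min_iff.1 hy.2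
  have hyIco : y ∈ Ico (-l 2) (l 0 + l 1) := ⟨hx.1.trans hy.1.le, hyl⟩
  refine ⟨hyIco, fun n hn => havoid (y - x) ⟨sub_pos.2 hy.1, sub_lt_iff_lt_add'.2 hyr⟩ n ?_⟩
  rwa [← AddCircle.coe_add, add_sub_cancel, cetMap_iterate_coe_mem_cetBreaks_iff hl ht hyIco]

theorem Inexhaustible.isMinimalMap_cetMap (h : Inexhaustible l)
    (hl : l ∈ stdSimplex ℝ (Fin 3)) : IsMinimalMap (cetMap l ((1 / 2 : ℝ) : UnitAddCircle)) := by
  have hhalf : (∑ k, l k) / 2 = 1 / 2 := by rw [hl.2]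
  have hmem : (1 / 2 : ℝ) ∈ Icc (0 : ℝ) 1 := by norm_num
  rw [← coe_cetEquiv hl]
  refine IsLocalReflection.isMinimalMap (finite_cetBreaks l) (isLocalReflection_cetEquiv hl _)
    (isLocalReflection_cetEquiv_symm hl _) (fun σ hσ n hn hcon => ?_) (fun p r hr => ?_)
  · apply h.not_hasConnection hn
    rw [hhalf]
    exact hasConnection_of_cetMap_iterate_mem hl hmem hσ hcon
  · by_contra! havoid
    obtain ⟨w, hw, hreg⟩ := exists_hasRegularInterval_of_cetMap_iterate_notMem hl hmem hr havoid
    exact h.not_hasRegularInterval hw (hhalf ▸ hreg)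

theorem IsMinimalMap.notMem_periodicPts {X : Type*} [TopologicalSpace X] [T1Space X] [Infinite X]
    {f : X → X} (hf : IsMinimalMap f) (p : X) : p ∉ Function.periodicPts f := by
  rintro ⟨n, hn, hp⟩
  have hfin : (range fun k => f^[k] p).Finite := by
    refine ((finite_lt_nat n).image fun k => f^[k] p).subset ?_
    rintro _ ⟨k, rfl⟩
    exact ⟨k % n, Nat.mod_lt _ hn, hp.iterate_mod_apply k⟩
  exact infinite_univ (hfin.isClosed.closure_eq.symm.trans (hf p).closure_eq ▸ hfin)

theorem infinite_addCircle (L : ℝ) [hL : Fact (0 < L)] : Infinite (AddCircle L) :=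
  (AddCircle.equivIco L 0).infinite_iff.2
    (Ico_infinite (lt_add_of_pos_right 0 hL.out)).to_subtype

theorem IsMinimalMap.aperiodic (hl : l ∈ stdSimplex ℝ (Fin 3)) (ht : t ∈ Icc (0 : ℝ) 1)
    (hmin : IsMinimalMap (cetMap l t)) : Aperiodic l t where
  admissible := admissible_of_mem_stdSimplex hl ht
  sum_pos := by rw [hl.2]; exact one_pos
  not_hasPeriodic := by
    rintro ⟨x, hx, n, hn, hper⟩
    have : Infinite UnitAddCircle := infinite_addCircle 1
    refine hmin.notMem_periodicPts x ⟨n, hn, ?_⟩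
    rw [Function.IsPeriodicPt, Function.IsFixedPt, cetMap_iterate_coe hl ht hx, hper.eq]

theorem rauzyCoord_of_mem_stdSimplex (hl : l ∈ stdSimplex ℝ (Fin 3)) :
    rauzyCoord l = fun j => 1 - 2 * l j := by
  funext j
  rw [rauzyCoord, hl.2, div_one]

end CircleExchange

theorem mainTheorem7 (l : Fin 3 → ℝ) (hl : l ∈ stdSimplex ℝ (Fin 3)) (τ : UnitAddCircle) :
    IsMinimalMap (cetMap l τ) ↔
      τ = ((1 / 2 : ℝ) : UnitAddCircle) ∧ (fun j => 1 - 2 * l j) ∈ rauzyGasket := by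
  have hsum : 0 < ∑ k, l k := by rw [hl.2]; exact one_pos
  rw [← rauzyCoord_of_mem_stdSimplex hl, ← inexhaustible_iff_rauzyCoord_mem_rauzyGasket hsum]
  constructor
  · intro hmin
    obtain ⟨t, ht, rfl⟩ := AddCircle.eq_coe_Ico τ
    obtain ⟨hinex, htwo⟩ :=
      (IsMinimalMap.aperiodic hl ⟨ht.1, ht.2.le⟩ hmin).inexhaustible_and_two_mul_eq
    have hhalf : t = 1 / 2 := by linarith [hl.2]
    exact ⟨by rw [hhalf], hinex⟩
  · rintro ⟨rfl, hinex⟩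
    exact hinex.isMinimalMap_cetMap hl
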